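/- Write $\sigma(n)=\sum_{d\mid n}d$, $G(n)=\dfrac{\sigma(n)}{n\log\log n}$, and for real $x>1$ and integers $k\ge 1$ $$F(x,k)=\frac{\log\bigl(1+1/(x+x^2+\cdots+x^k)\bigr)}{\log x}.$$ Let $E=\{F(p,k): p \text{ prime},\ k\ge 1\}$, and let $\epsilon_1>\epsilon_2>\cdots$ be the elements of $E$ in decreasing order. For $\epsilon\in E$ and $k\ge1$ let $x_k>1$ be the solution of $F(x_k,k)=\epsilon$ (so $x_1>x_2>\cdots$); for a prime $p$ let $a_p=k$ if $x_{k+1}<p\le x_k$ and $a_p=0$ if $p>x_1$. The colossally abundant number constructed from $\epsilon$ is $\prod_p p^{a_p}$, and $n_i$ denotes the one constructed from $\epsilon_i$. For $n\ge2$ let $P(n)$ be the largest prime factor of $n$. The number $n_i$ is called CA3 if $p<\log n_i$, where $p$ is the smallest prime greater than $P(n_i)$. **Theorem 3.** Let $i\ge1$, let $n_i$ be CA3, and let $p$ be the smallest prime greater than $P(n_i)$. 1) If $\epsilon_{i+1}=F(q,k)$ with $q\ge3$ prime and $k\ge1$, then $G(n_i)<G(n_{i+1})$; and if moreover $q$ is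 the only prime that represents $\epsilon_{i+1}$ (that is, $\epsilon_{i+1}=F(r,j)$ with $r$ prime and $j\ge1$ only for $r=q$), then $n_{i+1}/n_i=q$. 2) If $\epsilon_{i+1}=F(q,k)$ with $q\ge23$ prime and $k\ge1$, then $$G(n_i)<G(n_{i+1})\left(1-\frac{(\log q)^2}{3p^2\log p}\right);$$ and if moreover $q$ is the only prime that represents $\epsilon_{i+1}$, then $n_{i+1}/n_i=q$. 3) If $\epsilon_{i+1}=F(q,k)=F(r,j)$ with distinct primes $q\ge23$, $r\ge23$ and $k,j\ge1$, then $n_{i+1}/n_i=qr$ and $$G(n_i)<G(n_{i+1})\left(1-\frac{(\log q)^2}{3p^2\log p}\right)\left(1-\frac{(\log r)^2}{3p^2\log p}\right).$$ -/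

import Mathlib

noncomputable section

namespace CANumbers

/-- `ρ(n) = σ(n) / n`. -/
def rho (n : ℕ) : ℝ := (ArithmeticFunction.sigma 1 n : ℝ) / (n : ℝ)

/-- `G(n) = ρ(n) / log log n`. -/
def G (n : ℕ) : ℝ := rho n / Real.log (Real.log (n : ℝ))

/-- `F(x, k) = log (1 + 1 / (x + x ^ 2 + ⋯ + x ^ k)) / log x`, used for `x > 1` and `k ≥ 1`. -/
def F (x : ℝ) (k : ℕ) : ℝ :=
  Real.log (1 + 1 / ∑ j ∈ Finset.Icc 1 k, x ^ j) / Real.log x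

/-- The set `E` of critical parameters. -/
def critSet : Set ℝ := {e : ℝ | ∃ p k : ℕ, p.Prime ∧ 1 ≤ k ∧ e = F (p : ℝ) k}

/-- `ε_i` for `i ≥ 1`: the `i`-th largest critical parameter, i.e. the element `e` of `E` such that
exactly `i` elements of `E` are `≥ e`. Existence and uniqueness of such an element are proved in
`critEps_spec` and `critEps_eq_of_mem` below, so the supremum is over a one-element set. -/
def critEps (i : ℕ) : ℝ :=
  sSup {e : ℝ | e ∈ critSet ∧ {e' : ℝ | e' ∈ critSet ∧ e ≤ e'}.encard = (i : ℕ∞)}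

/-- `x_k`: the solution `x > 1` of `F(x, k) = ε`, for `ε > 0` and `k ≥ 1`. See `critX_spec` and
`critX_eq` for existence and uniqueness. -/
def critX (ε : ℝ) (k : ℕ) : ℝ := sSup {x : ℝ | 1 < x ∧ F x k = ε}

/-- The exponent of the prime `p` in the number constructed from `ε`: the `k ≥ 1` with
`x_{k+1} < p ≤ x_k` (unique, since `x_1 > x_2 > ⋯`), and `0` when there is none, i.e. when
`p > x_1`. -/
def caExponent (ε : ℝ) (p : ℕ) : ℕ :=
  sSup {k : ℕ | 1 ≤ k ∧ critX ε (k + 1) < (p : ℝ) ∧ (p : ℝ) ≤ critX ε k}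

/-- The colossally abundant number constructed from the critical parameter `ε`. Only primes
`p ≤ x_1` contribute a factor different from `1`. -/
def caOfEps (ε : ℝ) : ℕ := ∏ᶠ (p : ℕ) (_ : p.Prime), p ^ caExponent ε p

/-- `n_i`, for `i ≥ 1`: the colossally abundant number constructed from `ε_i`. -/
def caSeq (i : ℕ) : ℕ := caOfEps (critEps i)

/-- `P(n)`, for `n ≥ 2`: the largest prime factor of `n`. -/
def largestPrime (n : ℕ) : ℕ := sSup {p : ℕ | p.Prime ∧ p ∣ n}

/-- The prime succeeding `m`. -/
def nextPrime (m : ℕ) : ℕ := sInf {p : ℕ | p.Prime ∧ m < p}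

/-- The number `n` is of type CA3: with `p` the prime succeeding `P(n)`, one has `p < log n`.
Used for colossally abundant `n`. -/
def IsCA3 (n : ℕ) : Prop := (nextPrime (largestPrime n) : ℝ) < Real.log (n : ℝ)

theorem sum_pow_lt {k : ℕ} (hk : 1 ≤ k) {x y : ℝ} (hx : 0 ≤ x) (h : x < y) :
    ∑ j ∈ Finset.Icc 1 k, x ^ j < ∑ j ∈ Finset.Icc 1 k, y ^ j :=
  Finset.sum_lt_sum_of_nonempty ⟨1, by simp [hk]⟩ fun j hj =>
    pow_lt_pow_left₀ h hx (by have := (Finset.mem_Icc.1 hj).1; omega)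

theorem sum_pow_ge {k : ℕ} (hk : 1 ≤ k) {x : ℝ} (hx : 1 ≤ x) :
    x ≤ ∑ j ∈ Finset.Icc 1 k, x ^ j ∧ (k : ℝ) ≤ ∑ j ∈ Finset.Icc 1 k, x ^ j := by
  constructor
  · have := Finset.single_le_sum (f := fun j => x ^ j) (s := Finset.Icc 1 k) (a := 1)
      (fun j _ => by positivity) (by simp [hk])
    simpa using this
  · have : ∑ j ∈ Finset.Icc 1 k, (1 : ℝ) ≤ ∑ j ∈ Finset.Icc 1 k, x ^ j :=
      Finset.sum_le_sum fun j _ => one_le_pow₀ hx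
    simpa using this

theorem F_pos {k : ℕ} (hk : 1 ≤ k) {x : ℝ} (hx : 1 < x) : 0 < F x k := by
  have h := (sum_pow_ge hk hx.le).1
  have h0 : 0 < ∑ j ∈ Finset.Icc 1 k, x ^ j := by linarith
  have h1 : 0 < 1 / ∑ j ∈ Finset.Icc 1 k, x ^ j := by positivity
  exact div_pos (Real.log_pos (by linarith)) (Real.log_pos hx)

theorem F_lt_F {k : ℕ} (hk : 1 ≤ k) {x y : ℝ} (hx : 1 < x) (h : x < y) : F y k < F x k := by
  have hs := sum_pow_lt hk (by linarith : (0 : ℝ) ≤ x) h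
  have h0 := (sum_pow_ge hk hx.le).1
  have hA : 0 < ∑ j ∈ Finset.Icc 1 k, x ^ j := by linarith
  have h1 : 1 / ∑ j ∈ Finset.Icc 1 k, y ^ j < 1 / ∑ j ∈ Finset.Icc 1 k, x ^ j :=
    one_div_lt_one_div_of_lt hA hs
  have h2 : 0 < 1 / ∑ j ∈ Finset.Icc 1 k, y ^ j := by
    have := hA.trans hs
    positivity
  have hl : Real.log (1 + 1 / ∑ j ∈ Finset.Icc 1 k, y ^ j)
      < Real.log (1 + 1 / ∑ j ∈ Finset.Icc 1 k, x ^ j) :=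
    Real.log_lt_log (by linarith) (by linarith)
  exact div_lt_div₀ hl (Real.log_le_log (by linarith) h.le)
    (Real.log_nonneg (by linarith [Real.log_pos hx])) (Real.log_pos hx)

theorem F_le {k : ℕ} (hk : 1 ≤ k) {x : ℝ} (hx : 1 < x) :
    F x k ≤ 1 / ((∑ j ∈ Finset.Icc 1 k, x ^ j) * Real.log x) := by
  have h := (sum_pow_ge hk hx.le).1
  have h0 : 0 < ∑ j ∈ Finset.Icc 1 k, x ^ j := by linarith
  have h1 : 0 < 1 / ∑ j ∈ Finset.Icc 1 k, x ^ j := by positivity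
  have hl := Real.log_pos hx
  rw [F, ← div_div]
  gcongr
  have := Real.log_le_sub_one_of_pos (by linarith : 0 < 1 + 1 / ∑ j ∈ Finset.Icc 1 k, x ^ j)
  linarith

theorem critSet_finite {c : ℝ} (hc : 0 < c) : {e : ℝ | e ∈ critSet ∧ c ≤ e}.Finite := by
  have hl2 := Real.log_pos (by norm_num : (1 : ℝ) < 2)
  set B : ℕ := ⌈1 / (c * Real.log 2)⌉₊ with hB
  refine ((Set.finite_Iic B).prod (Set.finite_Iic B)).image
    (fun a : ℕ × ℕ => F (a.1 : ℝ) a.2) |>.subset ?_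
  rintro e ⟨⟨p, k, hp, hk, rfl⟩, hce⟩
  have hp2 : (2 : ℝ) ≤ p := by exact_mod_cast hp.two_le
  have hle := hce.trans (F_le hk (by linarith))
  obtain ⟨h1, h2⟩ := sum_pow_ge hk (by linarith : (1 : ℝ) ≤ p)
  have hlog : Real.log 2 ≤ Real.log p := Real.log_le_log (by norm_num) hp2
  have hA : ∑ j ∈ Finset.Icc 1 k, (p : ℝ) ^ j ≤ 1 / (c * Real.log 2) := by
    have hA0 : 0 < ∑ j ∈ Finset.Icc 1 k, (p : ℝ) ^ j := by linarith
    rw [le_div_iff₀ (mul_pos hA0 (hl2.trans_le hlog))] at hle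
    rw [le_div_iff₀ (by positivity)]
    have : (∑ j ∈ Finset.Icc 1 k, (p : ℝ) ^ j) * Real.log 2
        ≤ (∑ j ∈ Finset.Icc 1 k, (p : ℝ) ^ j) * Real.log p := by gcongr
    nlinarith
  have hle' := hA.trans (Nat.le_ceil _)
  refine ⟨(p, k), ⟨?_, ?_⟩, rfl⟩
  · exact_mod_cast h1.trans hle'
  · exact_mod_cast h2.trans hle'

theorem critSet_pos {e : ℝ} (he : e ∈ critSet) : 0 < e := by
  obtain ⟨p, k, hp, hk, rfl⟩ := he
  exact F_pos hk (by exact_mod_cast hp.one_lt)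

theorem exists_lt_mem_critSet {c : ℝ} (hc : c ∈ critSet) : ∃ e ∈ critSet, e < c := by
  obtain ⟨p, k, hp, hk, rfl⟩ := hc
  obtain ⟨r, hr, hr'⟩ := Nat.exists_infinite_primes (p + 1)
  exact ⟨F r k, ⟨r, k, hr', hk, rfl⟩, F_lt_F hk (by exact_mod_cast hp.one_lt)
    (by exact_mod_cast (by omega : p < r))⟩

theorem encard_unique {e f : ℝ} (he : e ∈ critSet) (hf : f ∈ critSet)
    (h : {e' : ℝ | e' ∈ critSet ∧ e ≤ e'}.encard = {e' : ℝ | e' ∈ critSet ∧ f ≤ e'}.encard) :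
    e = f := by
  wlog hef : e ≤ f generalizing e f
  · exact (this hf he h.symm (le_of_not_ge hef)).symm
  have hs : {e' : ℝ | e' ∈ critSet ∧ f ≤ e'} ⊆ {e' : ℝ | e' ∈ critSet ∧ e ≤ e'} :=
    fun x hx => ⟨hx.1, hef.trans hx.2⟩
  have := (critSet_finite (critSet_pos hf)).eq_of_subset_of_encard_le hs h.le
  have hm : e ∈ {e' : ℝ | e' ∈ critSet ∧ f ≤ e'} := by rw [this]; exact ⟨he, le_rfl⟩
  exact le_antisymm hef hm.2

theorem exists_encard (i : ℕ) : ∃ e ∈ critSet,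
    {e' : ℝ | e' ∈ critSet ∧ e ≤ e'}.encard = ((i + 1 : ℕ) : ℕ∞) := by
  induction i with
  | zero =>
    have h2 : F ((2 : ℕ) : ℝ) 1 ∈ critSet := ⟨2, 1, Nat.prime_two, le_rfl, rfl⟩
    obtain ⟨m, hm, hmax⟩ := Set.exists_max_image _ id (critSet_finite (critSet_pos h2))
      ⟨_, h2, le_rfl⟩
    refine ⟨m, hm.1, ?_⟩
    have : {e' : ℝ | e' ∈ critSet ∧ m ≤ e'} = {m} := by
      ext x
      constructor
      · rintro ⟨hx, hmx⟩
        exact le_antisymm (hmax x ⟨hx, hm.2.trans hmx⟩) hmx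
      · rintro rfl
        exact ⟨hm.1, le_rfl⟩
    rw [this]
    simp
  | succ i ih =>
    obtain ⟨e, he, hcard⟩ := ih
    obtain ⟨c, hc, hce⟩ := exists_lt_mem_critSet he
    obtain ⟨m, hm, hmax⟩ := Set.exists_max_image {s : ℝ | (s ∈ critSet ∧ c ≤ s) ∧ s < e} id
      ((critSet_finite (critSet_pos hc)).subset fun x hx => hx.1) ⟨c, ⟨hc, le_rfl⟩, hce⟩
    refine ⟨m, hm.1.1, ?_⟩
    have : {e' : ℝ | e' ∈ critSet ∧ m ≤ e'} = insert m {e' : ℝ | e' ∈ critSet ∧ e ≤ e'} := by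
      ext x
      constructor
      · rintro ⟨hx, hmx⟩
        by_cases hxe : e ≤ x
        · exact Or.inr ⟨hx, hxe⟩
        · exact Or.inl (le_antisymm (hmax x ⟨⟨hx, hm.1.2.trans hmx⟩, not_le.1 hxe⟩) hmx)
      · rintro (rfl | ⟨hx, hex⟩)
        · exact ⟨hm.1.1, le_rfl⟩
        · exact ⟨hx, hm.2.le.trans hex⟩
    rw [this, Set.encard_insert_of_notMem (fun h => absurd h.2 (not_le.2 hm.2)), hcard]
    push_cast
    rfl

/-- An element of `E` with exactly `i` elements of `E` above or equal to it is `ε_i`. -/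
theorem critEps_eq_of_mem {i : ℕ} {e : ℝ} (he : e ∈ critSet)
    (h : {e' : ℝ | e' ∈ critSet ∧ e ≤ e'}.encard = (i : ℕ∞)) : critEps i = e := by
  have : {e : ℝ | e ∈ critSet ∧ {e' : ℝ | e' ∈ critSet ∧ e ≤ e'}.encard = (i : ℕ∞)} = {e} := by
    ext x
    constructor
    · rintro ⟨hx, hxc⟩
      exact encard_unique hx he (hxc.trans h.symm)
    · rintro rfl
      exact ⟨he, h⟩
  rw [critEps, this, csSup_singleton]

theorem critEps_spec {i : ℕ} (hi : 1 ≤ i) : critEps i ∈ critSet ∧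
    {e' : ℝ | e' ∈ critSet ∧ critEps i ≤ e'}.encard = (i : ℕ∞) := by
  obtain ⟨e, he, hc⟩ := exists_encard (i - 1)
  rw [Nat.sub_add_cancel hi] at hc
  rw [critEps_eq_of_mem he hc]
  exact ⟨he, hc⟩

/-- Every element of `E` occurs as some `ε_i`. -/
theorem exists_critEps_eq {e : ℝ} (he : e ∈ critSet) : ∃ i : ℕ, 1 ≤ i ∧ critEps i = e := by
  have hfin := critSet_finite (critSet_pos he)
  have hcard := hfin.cast_ncard_eq
  refine ⟨_, ?_, critEps_eq_of_mem he hcard.symm⟩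
  exact (Set.ncard_pos hfin).2 ⟨e, he, le_rfl⟩

/-- Uniqueness of the solution `x_k`. -/
theorem critX_eq {ε : ℝ} {k : ℕ} (hk : 1 ≤ k) {x : ℝ} (hx : 1 < x) (h : F x k = ε) :
    critX ε k = x := by
  have : {x : ℝ | 1 < x ∧ F x k = ε} = {x} := by
    ext y
    constructor
    · rintro ⟨hy, hye⟩
      rcases lt_trichotomy y x with hlt | heq | hlt
      · have := F_lt_F hk hy hlt
        linarith
      · exact heq
      · have := F_lt_F hk hx hlt
        linarith
    · rintro rfl
      exact ⟨hx, h⟩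
  rw [critX, this, csSup_singleton]

/-- Existence of the solution `x_k`. -/
theorem critX_spec {ε : ℝ} (hε : 0 < ε) {k : ℕ} (hk : 1 ≤ k) :
    1 < critX ε k ∧ F (critX ε k) k = ε := by
  have hl2 := Real.log_pos (by norm_num : (1 : ℝ) < 2)
  set C : ℝ := ∑ j ∈ Finset.Icc 1 k, (2 : ℝ) ^ j with hC
  have hC0 : 0 < C := by linarith [(sum_pow_ge hk (by norm_num : (1 : ℝ) ≤ 2)).1]
  have hL : 0 < Real.log (1 + 1 / C) := Real.log_pos (by linarith [one_div_pos.2 hC0])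
  set t : ℝ := min (Real.log 2) (Real.log (1 + 1 / C) / ε) with ht
  have ht0 : 0 < t := lt_min hl2 (div_pos hL hε)
  have ha1 : 1 < Real.exp t := Real.one_lt_exp_iff.2 ht0
  have ha2 : Real.exp t ≤ 2 := by
    calc Real.exp t ≤ Real.exp (Real.log 2) := Real.exp_le_exp.2 (min_le_left _ _)
      _ = 2 := Real.exp_log (by norm_num)
  have hFa : ε ≤ F (Real.exp t) k := by
    rw [F, Real.log_exp, le_div_iff₀ ht0]
    have hA0 : 0 < ∑ j ∈ Finset.Icc 1 k, Real.exp t ^ j := by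
      linarith [(sum_pow_ge hk ha1.le).1]
    have hAC : ∑ j ∈ Finset.Icc 1 k, Real.exp t ^ j ≤ C :=
      Finset.sum_le_sum fun j _ => pow_le_pow_left₀ (by positivity) ha2 j
    have h1 : ε * t ≤ Real.log (1 + 1 / C) := by
      have := (le_div_iff₀ hε).1 (min_le_right (Real.log 2) (Real.log (1 + 1 / C) / ε))
      rw [mul_comm]
      exact this
    refine h1.trans (Real.log_le_log (by linarith [one_div_pos.2 hC0]) ?_)
    have := one_div_le_one_div_of_le hA0 hAC
    linarith
  set b : ℝ := max 3 (1 / ε) with hb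
  have hb3 : 3 ≤ b := le_max_left _ _
  have hFb : F b k ≤ ε := by
    have h1 := (sum_pow_ge hk (by linarith : (1 : ℝ) ≤ b)).1
    have hlog : 1 ≤ Real.log b := by
      rw [Real.le_log_iff_exp_le (by linarith)]
      linarith [Real.exp_one_lt_d9]
    refine (F_le hk (by linarith)).trans ?_
    have h2 : b ≤ (∑ j ∈ Finset.Icc 1 k, b ^ j) * Real.log b := by nlinarith
    calc 1 / ((∑ j ∈ Finset.Icc 1 k, b ^ j) * Real.log b) ≤ 1 / b :=
          one_div_le_one_div_of_le (by linarith) h2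
      _ ≤ 1 / (1 / ε) := one_div_le_one_div_of_le (by positivity) (le_max_right _ _)
      _ = ε := one_div_one_div ε
  have hcont : ContinuousOn (fun x => F x k) (Set.Icc (Real.exp t) b) := by
    intro x hx
    have hx1 : 1 < x := ha1.trans_le hx.1
    have hA0 : 0 < ∑ j ∈ Finset.Icc 1 k, x ^ j := by linarith [(sum_pow_ge hk hx1.le).1]
    have hA1 : 0 < 1 / ∑ j ∈ Finset.Icc 1 k, x ^ j := by positivity
    have hs : ContinuousAt (fun x : ℝ => ∑ j ∈ Finset.Icc 1 k, x ^ j) x := by fun_prop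
    refine ContinuousAt.continuousWithinAt ?_
    unfold F
    have hn : 1 + 1 / ∑ j ∈ Finset.Icc 1 k, x ^ j ≠ 0 := by positivity
    have hc : ContinuousAt (fun x : ℝ => 1 + 1 / ∑ j ∈ Finset.Icc 1 k, x ^ j) x :=
      continuousAt_const.add (continuousAt_const.div hs hA0.ne')
    exact (hc.log hn).div
      (Real.continuousAt_log (by linarith)) (Real.log_pos hx1).ne'
  obtain ⟨x, hx, hxε⟩ := intermediate_value_Icc' (by linarith) hcont ⟨hFb, hFa⟩
  have hx1 : 1 < x := ha1.trans_le hx.1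
  rw [critX_eq hk hx1 hxε]
  exact ⟨hx1, hxε⟩

/-- The solutions decrease: `x_{k+1} < x_k`. -/
theorem critX_succ_lt {ε : ℝ} (hε : 0 < ε) {k : ℕ} (hk : 1 ≤ k) :
    critX ε (k + 1) < critX ε k := by
  obtain ⟨h1, h2⟩ := critX_spec hε hk
  obtain ⟨h3, h4⟩ := critX_spec hε (k := k + 1) (by omega)
  by_contra hcon
  have hle : critX ε k ≤ critX ε (k + 1) := not_lt.1 hcon
  have hA0 : 0 < ∑ j ∈ Finset.Icc 1 k, critX ε (k + 1) ^ j := by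
    linarith [(sum_pow_ge hk h3.le).1]
  have hA : ∑ j ∈ Finset.Icc 1 k, critX ε (k + 1) ^ j
      < ∑ j ∈ Finset.Icc 1 (k + 1), critX ε (k + 1) ^ j := by
    rw [Finset.sum_Icc_succ_top (by omega)]
    have : 0 < critX ε (k + 1) ^ (k + 1) := by positivity
    linarith
  have hlt : F (critX ε (k + 1)) (k + 1) < F (critX ε (k + 1)) k := by
    have h5 := one_div_lt_one_div_of_lt hA0 hA
    have h6 := one_div_pos.2 (hA0.trans hA)
    exact div_lt_div_of_pos_right (Real.log_lt_log (by linarith) (by linarith))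
      (Real.log_pos h3)
  have hle2 : F (critX ε (k + 1)) k ≤ F (critX ε k) k := by
    rcases hle.lt_or_eq with h | h
    · exact (F_lt_F hk h1 h).le
    · rw [← h]
  linarith

end CANumbers

end

open CANumbers

/-! Passing from `ε_i` to `ε_{i+1}` raises by one the exponent of each prime representing `ε =
ε_{i+1}` and changes nothing else. So `n_{i+1} = n_i Q` with `Q` the product of these primes, and
since `r ^ F(r, k)` is the ratio of `ρ` at consecutive powers of `r`, `ρ` is multiplied by `Q ^ ε`
(`exists_representing_primes`). With `N = log n_i` and `L = log Q`, comparing `G` amounts to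
comparing `1 + log (1 + L / N) / log N` with `exp (ε L)` (`G_lt_G_mul_mul`).

The prime `p` does not divide `n_i`, so `F(p, 1) ≤ ε`, which bounds `exp (ε L)` below; CA3 gives `p
< N`, so `N` may be replaced by `p` on the other side. For `L ≥ 1` Bernoulli's inequality then
suffices. The quantitative gain comes from second-order expansions, valid for `p ≥ 23` and `3 ≤ L ≤
2 log p`; its factor involves `L ≥ log q`, which also covers the case where a second prime divides
`Q`.

The bound `L ≤ 2 log p`, and the identification `Q = q r`, require that at most two primes represent
`ε` (`card_le_two_of_represents`). Three such primes would have rational `ε`-th powers with `ε`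
irrational, contradicting the six exponentials theorem, proved here in the case needed: Siegel's
lemma builds an exponential sum vanishing on a grid, interpolation and integrality propagate the
zeros to a grid of twice the side, and that is more zeros than a nontrivial sum can have. -/

/-! ### Rolle's theorem, interpolation bounds and zeros of exponential sums -/

/-- Between the zeros of a differentiable function there are zeros of its derivative. -/
theorem exists_finset_zeros_deriv {f f' : ℝ → ℝ} (hf : ∀ x, HasDerivAt f (f' x) x)
    (Z : Finset ℝ) (hZ : ∀ x ∈ Z, f x = 0) :
    ∃ Z' : Finset ℝ, (∀ x ∈ Z', f' x = 0 ∧ (∃ y ∈ Z, y < x) ∧ ∃ y ∈ Z, x < y) ∧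
      Z.card ≤ Z'.card + 1 := by
  induction Z using Finset.induction_on_max with
  | empty => exact ⟨∅, by simp, by simp⟩
  | insert a s ha ih =>
    rcases s.eq_empty_or_nonempty with rfl | hs
    · exact ⟨∅, by simp, by simp⟩
    obtain ⟨Z', h1, h2⟩ := ih fun x hx => hZ x (Finset.mem_insert_of_mem hx)
    -- The new Rolle point lies above `max s`, the earlier ones strictly below it, so it is not
    -- counted twice.
    have hm := s.max'_mem hs
    obtain ⟨c, hc, hc0⟩ := exists_hasDerivAt_eq_zero (ha _ hm)
      (fun x _ => (hf x).continuousAt.continuousWithinAt)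
      (by rw [hZ _ (Finset.mem_insert_of_mem hm), hZ a (Finset.mem_insert_self _ _)])
      (fun x _ => hf x)
    refine ⟨insert c Z', ?_, ?_⟩
    · intro x hx
      rcases Finset.mem_insert.1 hx with rfl | hx
      · exact ⟨hc0, ⟨_, Finset.mem_insert_of_mem hm, hc.1⟩, a, Finset.mem_insert_self _ _, hc.2⟩
      · obtain ⟨h3, ⟨y, hy, hy'⟩, z, hz, hz'⟩ := h1 x hx
        exact ⟨h3, ⟨y, Finset.mem_insert_of_mem hy, hy'⟩, z, Finset.mem_insert_of_mem hz, hz'⟩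
    · have hcZ : c ∉ Z' := fun h => by
        obtain ⟨-, -, z, hz, hz'⟩ := h1 c h
        have := s.le_max' z hz
        linarith [hc.1]
      rw [Finset.card_insert_of_notMem hcZ,
        Finset.card_insert_of_notMem fun h => lt_irrefl _ (ha a h)]
      omega

/-- Iterated Rolle theorem for a sequence of successive derivatives. -/
theorem exists_zero_iterated_deriv {a b : ℝ} (n : ℕ) : ∀ {f : ℕ → ℝ → ℝ},
    (∀ k x, HasDerivAt (f k) (f (k + 1) x) x) → ∀ Z : Finset ℝ,
    (∀ x ∈ Z, f 0 x = 0 ∧ x ∈ Set.Icc a b) → n + 1 ≤ Z.card →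
    ∃ x ∈ Set.Icc a b, f n x = 0 := by
  induction n with
  | zero =>
    intro f _ Z hZ hc
    obtain ⟨x, hx⟩ := Finset.card_pos.1 (by omega : 0 < Z.card)
    exact ⟨x, (hZ x hx).2, (hZ x hx).1⟩
  | succ n ih =>
    intro f hf Z hZ hc
    obtain ⟨Z', h1, h2⟩ := exists_finset_zeros_deriv (hf 0) Z fun x hx => (hZ x hx).1
    refine ih (f := fun k => f (k + 1)) (fun k x => hf (k + 1) x) Z' (fun x hx => ?_) (by omega)
    obtain ⟨h3, ⟨y, hy, hy'⟩, z, hz, hz'⟩ := h1 x hx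
    exact ⟨h3, (hZ y hy).2.1.trans hy'.le, hz'.le.trans (hZ z hz).2.2⟩

theorem iterate_derivative_prod_X_sub_C (Z : Finset ℝ) :
    Polynomial.derivative^[Z.card] (∏ z ∈ Z, (Polynomial.X - Polynomial.C z)) =
      Polynomial.C (Z.card.factorial : ℝ) := by
  have hm : (∏ z ∈ Z, (Polynomial.X - Polynomial.C z)).Monic :=
    Polynomial.monic_prod_of_monic _ _ fun z _ => Polynomial.monic_X_sub_C z
  have hd : (∏ z ∈ Z, (Polynomial.X - Polynomial.C z)).natDegree = Z.card := by
    rw [Polynomial.natDegree_prod_of_monic _ _ fun z _ => Polynomial.monic_X_sub_C z]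
    simp
  ext m
  rw [Polynomial.coeff_iterate_derivative, Polynomial.coeff_C]
  split_ifs with h
  · subst h
    have := hm.coeff_natDegree
    rw [hd] at this
    simp [this, Nat.descFactorial_self]
  · rw [Polynomial.coeff_eq_zero_of_natDegree_lt (by omega), smul_zero]

/-- A function with `n` zeros in `[0, T]` is bounded there by `B T ^ n / n!`, where `B` bounds its
`n`-th derivative. -/
theorem abs_le_of_zeros {f : ℕ → ℝ → ℝ} (hf : ∀ k x, HasDerivAt (f k) (f (k + 1) x) x)
    {T B : ℝ} (Z : Finset ℝ) (hZ : ∀ x ∈ Z, f 0 x = 0 ∧ x ∈ Set.Icc 0 T)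
    (hB : ∀ x ∈ Set.Icc 0 T, |f Z.card x| ≤ B) {t : ℝ} (ht : t ∈ Set.Icc 0 T) :
    |f 0 t| ≤ B * T ^ Z.card / Z.card.factorial := by
  have hT : 0 ≤ T := ht.1.trans ht.2
  have hB0 : 0 ≤ B := (abs_nonneg _).trans (hB t ht)
  by_cases htZ : t ∈ Z
  · rw [(hZ t htZ).1, abs_zero]
    positivity
  set P : Polynomial ℝ := ∏ z ∈ Z, (Polynomial.X - Polynomial.C z) with hP
  -- The function `x ↦ f(x) P(t) - f(t) P(x)` vanishes on `Z` and at `t`. Its `n`-th derivative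
  -- therefore has a zero, and that of `P` is the constant `n!`.
  obtain ⟨x, hx, hx0⟩ := exists_zero_iterated_deriv (a := 0) (b := T) Z.card
    (f := fun k x => f k x * P.eval t - f 0 t * (Polynomial.derivative^[k] P).eval x)
    (fun k x => by
      have h1 := (Polynomial.derivative^[k] P).hasDerivAt x
      rw [← Function.iterate_succ_apply' (f := Polynomial.derivative)] at h1
      exact ((hf k x).mul_const _).sub (h1.const_mul _))
    (insert t Z) (by
      intro x hx
      rcases Finset.mem_insert.1 hx with rfl | hx
      · exact ⟨by simp, ht⟩
      · refine ⟨?_, (hZ x hx).2⟩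
        have : P.eval x = 0 := by
          rw [hP, Polynomial.eval_prod]
          exact Finset.prod_eq_zero hx (by simp)
        simp [(hZ x hx).1, this])
    (by rw [Finset.card_insert_of_notMem htZ])
  simp only [hP, iterate_derivative_prod_X_sub_C, Polynomial.eval_C] at hx0
  rw [le_div_iff₀ (by positivity)]
  have h1 : f 0 t * Z.card.factorial =
      f Z.card x * (∏ z ∈ Z, (Polynomial.X - Polynomial.C z)).eval t := by linarith
  have h2 := congrArg abs h1
  rw [abs_mul, abs_mul, Nat.abs_cast, Polynomial.eval_prod, Finset.abs_prod] at h2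
  rw [h2]
  refine mul_le_mul (hB x hx) ?_ (Finset.prod_nonneg fun _ _ => abs_nonneg _) hB0
  rw [← Finset.prod_const]
  refine Finset.prod_le_prod (fun _ _ => abs_nonneg _) fun z hz => ?_
  have := (hZ z hz).2
  rw [Polynomial.eval_sub, Polynomial.eval_X, Polynomial.eval_C, abs_le]
  constructor <;> linarith [ht.1, ht.2, this.1, this.2]

theorem hasDerivAt_sum_exp {ι : Type*} (s : Finset ι) (a w : ι → ℝ) (k : ℕ) (x : ℝ) :
    HasDerivAt (fun t => ∑ i ∈ s, a i * w i ^ k * Real.exp (w i * t))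
      (∑ i ∈ s, a i * w i ^ (k + 1) * Real.exp (w i * x)) x := by
  refine HasDerivAt.fun_sum fun i _ => ?_
  have h : HasDerivAt (fun t => w i * t) (w i) x := by
    simpa using (hasDerivAt_id x).const_mul (w i)
  refine (h.exp.const_mul (a i * w i ^ k)).congr_deriv ?_
  ring

/-- A real exponential sum with `N` distinct exponents and nonzero coefficients has fewer than `N`
real zeros. -/
theorem card_zeros_sum_exp_lt {ι : Type*} [DecidableEq ι] (s : Finset ι) :
    ∀ (a w : ι → ℝ), s.Nonempty → (∀ i ∈ s, a i ≠ 0) → Set.InjOn w s → ∀ Z : Finset ℝ,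
    (∀ t ∈ Z, ∑ i ∈ s, a i * Real.exp (w i * t) = 0) → Z.card < s.card := by
  induction s using Finset.induction_on with
  | empty => intro a w h; simp at h
  | insert j s hj ih =>
    intro a w _ ha hw Z hZ
    rcases s.eq_empty_or_nonempty with rfl | hs
    · have hZe : Z = ∅ := by
        refine Finset.eq_empty_of_forall_notMem fun t ht => ?_
        have := hZ t ht
        simp only [insert_empty_eq, Finset.sum_singleton, mul_eq_zero, Real.exp_ne_zero,
          or_false] at this
        exact ha j (by simp) this
      simp [hZe]
    -- Multiplying by `exp (-w j t)` keeps the zeros and makes the `j`-th term constant;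
    -- differentiating removes it, at the cost of at most one zero.
    have hder : ∀ x, HasDerivAt
        (fun t => ∑ i ∈ insert j s, a i * (w i - w j) ^ 0 * Real.exp ((w i - w j) * t))
        (∑ i ∈ s, a i * (w i - w j) * Real.exp ((w i - w j) * x)) x := fun x => by
      have h := hasDerivAt_sum_exp (insert j s) a (fun i => w i - w j) 0 x
      rw [Finset.sum_insert hj] at h
      simpa using h
    obtain ⟨Z', h1, h2⟩ := exists_finset_zeros_deriv hder Z fun t ht => by
      have h3 : ∑ i ∈ insert j s, a i * (w i - w j) ^ 0 * Real.exp ((w i - w j) * t)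
          = (∑ i ∈ insert j s, a i * Real.exp (w i * t)) * Real.exp (-(w j * t)) := by
        rw [Finset.sum_mul]
        refine Finset.sum_congr rfl fun i _ => ?_
        rw [mul_assoc (a i) (Real.exp _), ← Real.exp_add]
        ring_nf
      rw [h3, hZ t ht, zero_mul]
    have hwj : ∀ i ∈ s, w i - w j ≠ 0 := fun i hi h0 => by
      have := hw (Finset.mem_insert_of_mem hi) (Finset.mem_insert_self j s) (sub_eq_zero.1 h0)
      exact hj (this ▸ hi)
    have h4 := ih (fun i => a i * (w i - w j)) (fun i => w i - w j) hs
      (fun i hi => mul_ne_zero (ha i (Finset.mem_insert_of_mem hi)) (hwj i hi))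
      (fun x hx y hy hxy => hw (Finset.mem_insert_of_mem hx) (Finset.mem_insert_of_mem hy)
        (by simpa using hxy)) Z' fun t ht => (h1 t ht).1
    rw [Finset.card_insert_of_notMem hj]
    omega

/-! ### The six exponentials theorem for three primes -/

/-- With `m = 8 s ^ 5` and `n = s m`, the bound `n ^ n / n! ≤ e ^ n` makes the quantity at most `(K
(c e / s) ^ s) ^ m`, and `s` is taken so large that `c e / s ≤ 1 / 2` and `K < 2 ^ s`. This is the
decay that forces an integer to vanish in the extrapolation. -/
theorem exists_pow_mul_pow_div_factorial_lt_one {K c : ℝ} (hK : 0 < K) (hc : 0 ≤ c) :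
    ∃ s : ℕ, 1 ≤ s ∧
      K ^ (8 * s ^ 5) * (c * (8 * s ^ 5 : ℕ)) ^ (8 * s ^ 6) / (8 * s ^ 6).factorial < 1 := by
  obtain ⟨s₁, hs₁⟩ := pow_unbounded_of_one_lt K (by norm_num : (1 : ℝ) < 2)
  obtain ⟨s₂, hs₂⟩ := exists_nat_ge (2 * (c * Real.exp 1))
  set s : ℕ := s₁ + s₂ + 1 with hs
  have hs1 : 1 ≤ s := by omega
  have hs0 : (0 : ℝ) < s := by exact_mod_cast hs1
  refine ⟨s, hs1, ?_⟩
  set n : ℕ := 8 * s ^ 6 with hn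
  set m : ℕ := 8 * s ^ 5 with hm
  have hnm : n = s * m := by rw [hn, hm]; ring
  have hm0 : m ≠ 0 := by positivity
  have hm0' : (0 : ℝ) < m := by positivity
  have hK2 : K < 2 ^ s := hs₁.trans_le (pow_le_pow_right₀ (by norm_num) (by omega))
  have hs2 : 2 * (c * Real.exp 1) ≤ s := hs₂.trans (by exact_mod_cast (by omega : s₂ ≤ s))
  have h1 : (n : ℝ) ^ n / n.factorial ≤ Real.exp 1 ^ n := by
    rw [← Real.exp_nat_mul, mul_one]
    exact Real.pow_div_factorial_le_exp _ (by positivity) n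
  have h2 : (c * m) ^ n / n.factorial = (c / s) ^ n * ((n : ℝ) ^ n / n.factorial) := by
    rw [← mul_div_assoc, ← mul_pow, hnm]
    push_cast
    congr 2
    field_simp
  have h3 : (c * m) ^ n / n.factorial ≤ ((1 / 2) ^ s) ^ m := by
    rw [h2]
    calc (c / s) ^ n * ((n : ℝ) ^ n / n.factorial) ≤ (c / s) ^ n * Real.exp 1 ^ n := by gcongr
      _ = (c * Real.exp 1 / s) ^ n := by rw [← mul_pow]; congr 1; ring
      _ ≤ (1 / 2) ^ n := by
        refine pow_le_pow_left₀ (by positivity) ?_ n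
        rw [div_le_iff₀ hs0]
        linarith
      _ = ((1 / 2) ^ s) ^ m := by rw [← pow_mul, hnm]
  calc K ^ m * (c * m) ^ n / n.factorial = K ^ m * ((c * m) ^ n / n.factorial) := by ring
    _ ≤ K ^ m * ((1 / 2) ^ s) ^ m := by gcongr
    _ = (K * (1 / 2) ^ s) ^ m := by rw [mul_pow]
    _ < 1 := by
      refine pow_lt_one₀ (by positivity) ?_ hm0
      rw [one_div, inv_pow, ← div_eq_mul_inv, div_lt_one (by positivity)]
      exact hK2

theorem prod_prime_pow_injective {ι : Type*} [Fintype ι] {P : ι → ℕ} (hP : ∀ i, (P i).Prime)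
    (hinj : Function.Injective P) :
    Function.Injective fun μ : ι → ℕ => ∏ i, P i ^ μ i := by
  classical
  intro μ ν h
  funext j
  have key : ∀ μ : ι → ℕ, (∏ i, P i ^ μ i).factorization (P j) = μ j := fun μ => by
    rw [Nat.factorization_prod fun i _ => pow_ne_zero _ (hP i).ne_zero, Finsupp.finsetSum_apply,
      Finset.sum_eq_single j]
    · simp [(hP j).factorization_pow]
    · intro i _ hi
      rw [(hP i).factorization_pow, Finsupp.single_eq_of_ne]
      exact fun h => hi (hinj h.symm)
    · simp
  rw [← key μ, ← key ν]
  exact congrArg (fun n => n.factorization (P j)) h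

/-- Unique factorization, after exponentiating. It ensures that grids of exponent vectors give as
many distinct points on the real line. -/
theorem sum_mul_log_prime_injective {ι : Type*} [Fintype ι] {P : ι → ℕ} (hP : ∀ i, (P i).Prime)
    (hinj : Function.Injective P) :
    Function.Injective fun μ : ι → ℕ => ∑ i, (μ i : ℝ) * Real.log (P i) := by
  have key : ∀ μ : ι → ℕ, Real.exp (∑ i, (μ i : ℝ) * Real.log (P i)) =
      ((∏ i, P i ^ μ i : ℕ) : ℝ) := fun μ => by
    rw [Real.exp_sum, Nat.cast_prod]
    refine Finset.prod_congr rfl fun i _ => ?_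
    rw [Real.exp_nat_mul, Real.exp_log (by exact_mod_cast (hP i).pos), Nat.cast_pow]
  intro μ ν h
  apply prod_prime_pow_injective hP hinj
  have := congrArg Real.exp h
  simp only [key] at this
  exact_mod_cast this

theorem exists_common_denominator {ι : Type*} [Fintype ι] {x : ι → ℝ} (hx : ∀ i, 0 < x i)
    (h : ∀ i, ∃ a : ℚ, x i = a) :
    ∃ (d : ℕ) (v : ι → ℕ), 0 < d ∧ ∀ i, 0 < v i ∧ (v i : ℝ) = d * x i := by
  choose a ha using h
  set d : ℕ := ∏ i, (a i).den with hd
  have hd0 : 0 < d := Finset.prod_pos fun i _ => (a i).den_pos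
  have : ∀ i, ∃ v : ℕ, (v : ℝ) = d * x i := fun i => by
    obtain ⟨c, hc⟩ : (a i).den ∣ d := Finset.dvd_prod_of_mem _ (Finset.mem_univ i)
    have ha0 : 0 < a i := by
      have := hx i
      rw [ha i] at this
      exact_mod_cast this
    refine ⟨(a i).num.toNat * c, ?_⟩
    have h1 : (((a i).num.toNat : ℤ) : ℚ) = a i * (a i).den := by
      rw [Int.toNat_of_nonneg (Rat.num_nonneg.2 ha0.le), Rat.mul_den_eq_num]
    have h2 : ((a i).num.toNat : ℝ) = (a i : ℝ) * (a i).den := by exact_mod_cast h1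
    rw [ha i, hc]
    push_cast
    rw [h2]
    ring
  choose v hv using this
  refine ⟨d, v, hd0, fun i => ⟨?_, hv i⟩⟩
  have : (0 : ℝ) < v i := by
    rw [hv i]
    have := hx i
    positivity
  exact_mod_cast this

open Matrix in
attribute [local instance] Matrix.seminormedAddCommGroup in
/-- Siegel's lemma with twice as many unknowns as equations. -/
theorem exists_small_int_solution {α β : Type*} [Fintype α] [Fintype β] (A : α → β → ℤ)
    (hα : 0 < Fintype.card α) (hβ : Fintype.card β = 2 * Fintype.card α) {H : ℝ} (hH : 1 ≤ H)
    (hA : ∀ i j, |(A i j : ℝ)| ≤ H) :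
    ∃ t : β → ℤ, t ≠ 0 ∧ (∀ i, ∑ j, A i j * t j = 0) ∧
      ∀ j, |(t j : ℝ)| ≤ Fintype.card β * H := by
  classical
  obtain ⟨t, ht0, ht, hn⟩ := Int.Matrix.exists_ne_zero_int_vec_norm_le (Matrix.of A)
    (by omega) hα
  refine ⟨t, ht0, fun i => congrFun ht i, fun j => ?_⟩
  have h1 : ‖Matrix.of A‖ ≤ H := by
    rw [Matrix.norm_le_iff (by linarith)]
    intro i j
    rw [Int.norm_eq_abs]
    exact hA i j
  have hα' : (0 : ℝ) < Fintype.card α := by exact_mod_cast hα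
  -- The Siegel exponent `m / (n - m)` equals `1` because `n = 2 m`, so the bound is linear in the
  -- height.
  have he : ((Fintype.card α : ℝ) / (Fintype.card β - Fintype.card α)) = 1 := by
    rw [hβ]
    push_cast
    rw [div_eq_one_iff_eq] <;> linarith
  rw [he, Real.rpow_one] at hn
  have h2 := (norm_le_pi_norm t j).trans hn
  rw [Int.norm_eq_abs] at h2
  refine h2.trans ?_
  gcongr
  exact max_le hH h1

/-- The value at `∑ μ i log (P i)` of the exponential with exponent `a + b ε`, cleared of
denominators. -/
theorem cast_prod_entry {ι : Type*} [Fintype ι] {P v : ι → ℕ} {d : ℕ} {ε : ℝ}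
    (hP : ∀ i, 0 < P i) (hv : ∀ i, (v i : ℝ) = d * (P i : ℝ) ^ ε) {L a b : ℕ} (hb : b ≤ L)
    (μ : ι → ℕ) :
    ((∏ i, (P i ^ a * v i ^ b * d ^ (L - b)) ^ μ i : ℕ) : ℝ) =
      (d : ℝ) ^ (L * ∑ i, μ i) *
        Real.exp ((a + b * ε) * ∑ i, (μ i : ℝ) * Real.log (P i)) := by
  rw [Finset.mul_sum, Finset.mul_sum, Real.exp_sum, ← Finset.prod_pow_eq_pow_sum,
    ← Finset.prod_mul_distrib, Nat.cast_prod]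
  refine Finset.prod_congr rfl fun i _ => ?_
  have hPi : (0 : ℝ) < P i := by exact_mod_cast hP i
  have h1 : Real.exp ((a + b * ε) * ((μ i : ℝ) * Real.log (P i))) =
      ((P i : ℝ) ^ a * ((P i : ℝ) ^ ε) ^ b) ^ μ i := by
    rw [← Real.rpow_natCast _ a, ← Real.rpow_mul_natCast hPi.le, ← Real.rpow_add hPi,
      ← Real.rpow_mul_natCast hPi.le, Real.rpow_def_of_pos hPi]
    ring_nf
  rw [h1, pow_mul, ← mul_pow]
  push_cast
  rw [hv i, mul_pow (d : ℝ)]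
  congr 1
  obtain ⟨k, rfl⟩ := Nat.exists_eq_add_of_le hb
  rw [Nat.add_sub_cancel_left, pow_add]
  ring

/-- Height bound for the Siegel matrix. Every base is at least `1`, so all exponents may be raised
to their maximum; the result is exponential in `L * M` only. -/
theorem prod_entry_le {ι : Type*} [Fintype ι] {P v : ι → ℕ} {d : ℕ}
    (hP : ∀ i, 0 < P i) (hv : ∀ i, 0 < v i) (hd : 0 < d) {L M a b : ℕ} (ha : a ≤ L) (hb : b ≤ L)
    {μ : ι → ℕ} (hμ : ∀ i, μ i ≤ M) :
    ∏ i, (P i ^ a * v i ^ b * d ^ (L - b)) ^ μ i ≤ (∏ i, P i * v i * d) ^ (L * M) := by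
  rw [← Finset.prod_pow]
  refine Finset.prod_le_prod' fun i _ => ?_
  rw [pow_mul]
  have h1 : P i ^ a * v i ^ b * d ^ (L - b) ≤ (P i * v i * d) ^ L := by
    rw [mul_pow, mul_pow]
    exact Nat.mul_le_mul (Nat.mul_le_mul (Nat.pow_le_pow_right (hP i) ha)
      (Nat.pow_le_pow_right (hv i) hb)) (Nat.pow_le_pow_right hd (Nat.sub_le _ _))
  have h2 : 0 < (P i * v i * d) ^ L :=
    pow_pos (Nat.mul_pos (Nat.mul_pos (hP i) (hv i)) hd) _
  exact (Nat.pow_le_pow_left h1 _).trans (Nat.pow_le_pow_right h2 (hμ i))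

theorem sum_mul_log_mem_Icc {ι : Type*} [Fintype ι] {P μ : ι → ℕ} {M : ℕ}
    (hμ : ∀ i, μ i ≤ M) :
    ∑ i, (μ i : ℝ) * Real.log (P i) ∈ Set.Icc 0 (M * ∑ i, Real.log (P i)) := by
  have hl : ∀ i, 0 ≤ Real.log (P i) := fun i => Real.log_natCast_nonneg _
  refine ⟨Finset.sum_nonneg fun i _ => mul_nonneg (by positivity) (hl i), ?_⟩
  rw [Finset.mul_sum]
  refine Finset.sum_le_sum fun i _ => mul_le_mul_of_nonneg_right ?_ (hl i)
  exact_mod_cast hμ i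

/-- If an exponential sum with integral coefficients and exponents `a + b ε`, `a, b < L`, vanishes
at all `∑ μ i log (P i)` with `μ i < M`, where `L ^ 2 < M ^ 3`, it is trivial. -/
theorem eq_zero_of_forall_grid_eq_zero {P : Fin 3 → ℕ} (hP : ∀ i, (P i).Prime)
    (hinj : Function.Injective P) {ε : ℝ} (hε : Irrational ε) {L M : ℕ} (hLM : L ^ 2 < M ^ 3)
    (t : Fin L × Fin L → ℝ)
    (h : ∀ μ : Fin 3 → Fin M, ∑ l, t l *
      Real.exp (((l.1 : ℕ) + (l.2 : ℕ) * ε) * ∑ i, ((μ i : ℕ) : ℝ) * Real.log (P i)) = 0) :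
    t = 0 := by
  classical
  by_contra ht
  obtain ⟨l, hl⟩ := Function.ne_iff.1 ht
  have hinjθ : Function.Injective fun μ : Fin 3 → Fin M =>
      ∑ i, ((μ i : ℕ) : ℝ) * Real.log (P i) := fun μ ν hμν => by
    have := sum_mul_log_prime_injective hP hinj (a₁ := fun i => (μ i : ℕ))
      (a₂ := fun i => (ν i : ℕ)) hμν
    funext i
    exact Fin.ext (congrFun this i)
  -- Irrationality of `ε` makes the exponents `a + b ε` distinct.
  have hw : Function.Injective fun l : Fin L × Fin L => (((l.1 : ℕ) : ℝ) + (l.2 : ℕ) * ε) := by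
    rintro ⟨a, b⟩ ⟨a', b'⟩ hab
    simp only at hab
    have hb : b = b' := by
      by_contra hne
      have hne' : (((b : ℕ) : ℤ) - ((b' : ℕ) : ℤ)) ≠ 0 := by
        have : (b : ℕ) ≠ b' := fun h => hne (Fin.ext h)
        omega
      refine (hε.intCast_mul hne').ne_int ((a' : ℕ) - (a : ℕ) : ℤ) ?_
      push_cast
      linarith
    subst hb
    have : ((a : ℕ) : ℝ) = (a' : ℕ) := by linarith
    rw [Fin.ext (by exact_mod_cast this : (a : ℕ) = a')]
  -- Only the terms with nonzero coefficient are kept, at most `L ^ 2` of them, against `M ^ 3`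
  -- zeros.
  have := card_zeros_sum_exp_lt (Finset.univ.filter fun l => t l ≠ 0) t _
    ⟨l, by simpa using hl⟩ (by simp) hw.injOn
    (Finset.univ.image fun μ : Fin 3 → Fin M => ∑ i, ((μ i : ℕ) : ℝ) * Real.log (P i)) (by
      intro x hx
      obtain ⟨μ, -, rfl⟩ := Finset.mem_image.1 hx
      refine Eq.trans ?_ (h μ)
      refine Finset.sum_subset (Finset.filter_subset _ _) fun l _ hl => ?_
      rw [Finset.mem_filter, not_and, not_not] at hl
      rw [hl (Finset.mem_univ _), zero_mul])
  rw [Finset.card_image_of_injective _ hinjθ] at this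
  have h2 := Finset.card_filter_le (Finset.univ : Finset (Fin L × Fin L)) fun l => t l ≠ 0
  simp only [Finset.card_univ, Fintype.card_pi, Finset.prod_const, Fintype.card_fin,
    Fintype.card_prod] at this h2
  nlinarith

/-- **Six exponentials theorem**, for three primes and a real exponent whose powers are rational. -/
theorem not_rational_rpow_three_primes {P : Fin 3 → ℕ} (hP : ∀ i, (P i).Prime)
    (hinj : Function.Injective P) {ε : ℝ} (hε : Irrational ε) (hε0 : 0 ≤ ε) (hε1 : ε ≤ 1)
    (hrat : ∀ i, ∃ a : ℚ, (P i : ℝ) ^ ε = a) : False := by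
  classical
  have hP0 : ∀ i, 0 < P i := fun i => (hP i).pos
  obtain ⟨d, v, hd, hv⟩ := exists_common_denominator
    (fun i => Real.rpow_pos_of_pos (by exact_mod_cast hP0 i : (0 : ℝ) < P i) ε) hrat
  set c : ℝ := ∑ i, Real.log (P i) with hc
  have hc0 : 0 ≤ c := Finset.sum_nonneg fun i _ => Real.log_natCast_nonneg _
  set C : ℕ := ∏ i, P i * v i * d with hC
  have hC0 : 0 < C :=
    Finset.prod_pos fun i _ => Nat.mul_pos (Nat.mul_pos (hP0 i) (hv i).1) hd
  have hC1 : (1 : ℝ) ≤ C := by exact_mod_cast hC0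
  have hd1 : (1 : ℝ) ≤ d := by exact_mod_cast hd
  -- `K` collects all factors of growth `O(1) ^ (L M)`: `d ^ 6` from the denominators, `16` from `L
  -- ^ 4`, `C` from the Siegel matrix, `exp (4 c)` from the exponentials.
  obtain ⟨s, hs1, hs⟩ := exists_pow_mul_pow_div_factorial_lt_one
    (K := (d : ℝ) ^ 6 * 16 * C * Real.exp (4 * c)) (by positivity)
    (by positivity : 0 ≤ 4 * c)
  -- These sizes give `L ^ 2 = 2 M ^ 3`, twice as many unknowns as equations, while `M ^ 3 = s L M`
  -- outgrows `L M`.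
  set L : ℕ := 4 * s ^ 3 with hL
  set M : ℕ := 2 * s ^ 2 with hM
  have hLM : L * M = 8 * s ^ 5 := by rw [hL, hM]; ring
  have hM3 : M ^ 3 = 8 * s ^ 6 := by rw [hM]; ring
  rw [← hLM, ← hM3] at hs
  have hM0 : 0 < M := by positivity
  have hL0 : 0 < L := by positivity
  set E : (Fin 3 → ℕ) → Fin L × Fin L → ℕ := fun μ l =>
    ∏ i, (P i ^ (l.1 : ℕ) * v i ^ (l.2 : ℕ) * d ^ (L - l.2)) ^ μ i with hE
  obtain ⟨t, ht0, ht, htb⟩ := exists_small_int_solution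
    (fun (μ : Fin 3 → Fin M) (l : Fin L × Fin L) => (E (fun i => μ i) l : ℤ))
    (by simp [hM0]) (by simp [hL, hM]; ring) (one_le_pow₀ hC1 : (1 : ℝ) ≤ C ^ (L * M))
    (fun μ l => by
      rw [Int.cast_natCast, Nat.abs_cast]
      exact_mod_cast prod_entry_le hP0 (fun i => (hv i).1) hd l.1.2.le l.2.2.le
        fun i => (μ i).2.le)
  have hcard : ((Fintype.card (Fin L × Fin L) : ℕ) : ℝ) = (L : ℝ) ^ 2 := by simp [sq]
  rw [hcard] at htb
  set w : Fin L × Fin L → ℝ := fun l => ((l.1 : ℕ) : ℝ) + ((l.2 : ℕ) : ℝ) * ε with hw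
  have hw0 : ∀ l, 0 ≤ w l := fun l => by positivity
  have hw2 : ∀ l, w l ≤ 2 * L := fun l => by
    have h1 : (((l.1 : ℕ) : ℝ)) ≤ L := by exact_mod_cast l.1.2.le
    have h2 : (((l.2 : ℕ) : ℝ)) ≤ L := by exact_mod_cast l.2.2.le
    have h3 : ((l.2 : ℕ) : ℝ) * ε ≤ L * 1 := by gcongr
    simp only [hw]
    linarith
  set f : ℕ → ℝ → ℝ := fun k x => ∑ l, (t l : ℝ) * w l ^ k * Real.exp (w l * x) with hf
  have hval : ∀ μ : Fin 3 → ℕ, (d : ℝ) ^ (L * ∑ i, μ i) *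
      f 0 (∑ i, (μ i : ℝ) * Real.log (P i)) = ((∑ l, (E μ l : ℤ) * t l : ℤ) : ℝ) := fun μ => by
    simp only [hf]
    rw [Finset.mul_sum]
    push_cast
    refine Finset.sum_congr rfl fun l _ => ?_
    simp only [hE]
    rw [cast_prod_entry hP0 (fun i => (hv i).2) l.2.2.le μ]
    ring
  set θ : (Fin 3 → Fin M) → ℝ := fun μ => ∑ i, ((μ i : ℕ) : ℝ) * Real.log (P i) with hθ
  have hθinj : Function.Injective θ := fun μ ν hμν => by
    have := sum_mul_log_prime_injective hP hinj (a₁ := fun i => (μ i : ℕ))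
      (a₂ := fun i => (ν i : ℕ)) hμν
    funext i
    exact Fin.ext (congrFun this i)
  -- The interval must contain the grid of side `2 M` as well as that of side `M`.
  set T : ℝ := (2 * M : ℕ) * c with hT
  set B : ℝ := (L : ℝ) ^ 2 * ((L : ℝ) ^ 2 * C ^ (L * M) * (2 * L) ^ (M ^ 3) *
    Real.exp (2 * L * T)) with hB
  have hZcard : (Finset.univ.image θ).card = M ^ 3 := by
    rw [Finset.card_image_of_injective _ hθinj]
    simp
  have hbound : ∀ x ∈ Set.Icc 0 T, |f (M ^ 3) x| ≤ B := fun x hx => by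
    refine (Finset.abs_sum_le_sum_abs _ _).trans ?_
    have : ∀ l ∈ Finset.univ, |(t l : ℝ) * w l ^ (M ^ 3) * Real.exp (w l * x)| ≤
        (L : ℝ) ^ 2 * C ^ (L * M) * (2 * L) ^ (M ^ 3) * Real.exp (2 * L * T) := fun l _ => by
      rw [abs_mul, abs_mul, Real.abs_exp, abs_of_nonneg (pow_nonneg (hw0 l) _)]
      have h1 := htb l
      have h2 := hw2 l
      have h3 := hw0 l
      have h4 := hx.1
      have h5 := hx.2
      gcongr
    refine (Finset.sum_le_card_nsmul _ _ _ this).trans_eq ?_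
    rw [nsmul_eq_mul, Finset.card_univ, hcard]
  -- Extrapolation: the value of `f 0` at a point of the larger grid, times a power of `d`, is an
  -- integer, and the `M ^ 3` zeros already known make it smaller than `1`.
  have hzero : ∀ μ : Fin 3 → Fin (2 * M),
      f 0 (∑ i, ((μ i : ℕ) : ℝ) * Real.log (P i)) = 0 := fun μ => by
    have h1 := abs_le_of_zeros (f := f) (fun k x => hasDerivAt_sum_exp _ _ _ k x)
      (T := T) (B := B) (Finset.univ.image θ) (by
        intro x hx
        obtain ⟨ν, -, rfl⟩ := Finset.mem_image.1 hx
        constructor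
        · have h := hval fun i => (ν i : ℕ)
          rw [ht ν, Int.cast_zero] at h
          exact (mul_eq_zero.1 h).resolve_left (by positivity)
        · exact sum_mul_log_mem_Icc fun i => by have := (ν i).2; omega)
      (by rwa [hZcard])
      (sum_mul_log_mem_Icc fun i => (μ i).2.le :
        ∑ i, ((μ i : ℕ) : ℝ) * Real.log (P i) ∈ Set.Icc 0 T)
    rw [hZcard] at h1
    have h := hval fun i => (μ i : ℕ)
    set n : ℤ := ∑ l, (E (fun i => (μ i : ℕ)) l : ℤ) * t l
    have hn : |(n : ℝ)| < 1 := by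
      rw [← h, abs_mul, abs_of_nonneg (by positivity)]
      have hsum : ∑ i, (μ i : ℕ) ≤ 6 * M := by
        have := Finset.sum_le_card_nsmul Finset.univ (fun i => (μ i : ℕ)) (2 * M)
          fun i _ => (μ i).2.le
        simp only [Finset.card_univ, Fintype.card_fin, smul_eq_mul] at this
        omega
      have hd6 : (d : ℝ) ^ (L * ∑ i, (μ i : ℕ)) ≤ (d ^ 6) ^ (L * M) := by
        rw [← pow_mul]
        refine pow_le_pow_right₀ hd1 ?_
        calc L * ∑ i, (μ i : ℕ) ≤ L * (6 * M) := Nat.mul_le_mul_left _ hsum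
          _ = 6 * (L * M) := by ring
      have hL4 : (L : ℝ) ^ 2 * (L : ℝ) ^ 2 ≤ 16 ^ (L * M) := by
        have h2 : (L : ℝ) ≤ 2 ^ L := by exact_mod_cast Nat.lt_two_pow_self.le
        calc (L : ℝ) ^ 2 * (L : ℝ) ^ 2 ≤ (2 ^ L) ^ 2 * (2 ^ L) ^ 2 := by gcongr
          _ = 16 ^ L := by
            rw [← pow_mul, ← pow_add, (by norm_num : (16 : ℝ) = 2 ^ 4), ← pow_mul]
            congr 1
            ring
          _ ≤ 16 ^ (L * M) := pow_le_pow_right₀ (by norm_num) (Nat.le_mul_of_pos_right _ hM0)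
      have hexp : Real.exp (2 * L * T) = Real.exp (4 * c) ^ (L * M) := by
        rw [← Real.exp_nat_mul, hT]
        push_cast
        ring_nf
      refine lt_of_le_of_lt ?_ hs
      calc (d : ℝ) ^ (L * ∑ i, (μ i : ℕ)) * |f 0 (∑ i, ((μ i : ℕ) : ℝ) * Real.log (P i))|
          ≤ (d ^ 6) ^ (L * M) * (B * T ^ (M ^ 3) / (M ^ 3).factorial) := by gcongr
        _ = (d ^ 6) ^ (L * M) * ((L : ℝ) ^ 2 * (L : ℝ) ^ 2) * C ^ (L * M) *
            Real.exp (4 * c) ^ (L * M) * (4 * c * (L * M : ℕ)) ^ (M ^ 3) /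
              (M ^ 3).factorial := by
          have : (4 * c * (L * M : ℕ)) = 2 * L * T := by rw [hT]; push_cast; ring
          rw [hB, hexp, this, mul_pow (2 * (L : ℝ))]
          ring
        _ ≤ (d ^ 6) ^ (L * M) * 16 ^ (L * M) * C ^ (L * M) *
            Real.exp (4 * c) ^ (L * M) * (4 * c * (L * M : ℕ)) ^ (M ^ 3) /
              (M ^ 3).factorial := by gcongr
        _ = _ := by rw [mul_pow _ (Real.exp _), mul_pow _ (C : ℝ), mul_pow _ (16 : ℝ)]
    have hn0 : n = 0 := by
      rw [← Int.abs_lt_one_iff]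
      exact_mod_cast hn
    rw [hn0, Int.cast_zero] at h
    exact (mul_eq_zero.1 h).resolve_left (by positivity)
  -- The larger grid has `64 s ^ 6` points, more than the `L ^ 2 = 16 s ^ 6` terms.
  have := eq_zero_of_forall_grid_eq_zero hP hinj hε (L := L) (M := 2 * M) (by
      rw [mul_pow 2 M, hM3, hL]
      have : 0 < s ^ 6 := by positivity
      ring_nf
      omega) (fun l => (t l : ℝ)) (fun μ => by
        have := hzero μ
        simpa [hf, hw] using this)
  exact ht0 (funext fun l => Int.cast_eq_zero.1 (congrFun this l))

/-! ### Exponents of colossally abundant numbers and the passage to the next one -/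

namespace CANumbers

theorem F_succ_lt {k : ℕ} (hk : 1 ≤ k) {x : ℝ} (hx : 1 < x) : F x (k + 1) < F x k := by
  have hA0 : 0 < ∑ j ∈ Finset.Icc 1 k, x ^ j := by linarith [(sum_pow_ge hk hx.le).1]
  have hA : ∑ j ∈ Finset.Icc 1 k, x ^ j < ∑ j ∈ Finset.Icc 1 (k + 1), x ^ j := by
    rw [Finset.sum_Icc_succ_top (by omega)]
    have : 0 < x ^ (k + 1) := by positivity
    linarith
  have h5 := one_div_lt_one_div_of_lt hA0 hA
  have h6 := one_div_pos.2 (hA0.trans hA)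
  exact div_lt_div_of_pos_right (Real.log_lt_log (by linarith) (by linarith)) (Real.log_pos hx)

theorem F_lt_of_lt {k l : ℕ} (hk : 1 ≤ k) (hkl : k < l) {x : ℝ} (hx : 1 < x) :
    F x l < F x k := by
  induction l, hkl using Nat.le_induction with
  | base => exact F_succ_lt hk hx
  | succ l hl ih => exact (F_succ_lt (by omega) hx).trans ih

theorem F_le_of_le {k l : ℕ} (hk : 1 ≤ k) (hkl : k ≤ l) {x : ℝ} (hx : 1 < x) :
    F x l ≤ F x k := by
  rcases hkl.eq_or_lt with rfl | h
  · exact le_rfl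
  · exact (F_lt_of_lt hk h hx).le

theorem F_inj {k l : ℕ} (hk : 1 ≤ k) (hl : 1 ≤ l) {x : ℝ} (hx : 1 < x) (h : F x k = F x l) :
    k = l := by
  rcases lt_trichotomy k l with hlt | heq | hlt
  · exact absurd h (F_lt_of_lt hk hlt hx).ne'
  · exact heq
  · exact absurd h (F_lt_of_lt hl hlt hx).ne

theorem le_critX_iff {ε : ℝ} (hε : 0 < ε) {k : ℕ} (hk : 1 ≤ k) {x : ℝ} (hx : 1 < x) :
    x ≤ critX ε k ↔ ε ≤ F x k := by
  obtain ⟨h1, h2⟩ := critX_spec hε hk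
  constructor
  · intro h
    rcases h.eq_or_lt with h | h
    · rw [h, h2]
    · exact h2 ▸ (F_lt_F hk hx h).le
  · intro h
    by_contra hcon
    have := F_lt_F hk h1 (not_le.1 hcon)
    linarith

theorem exists_F_lt {ε : ℝ} (hε : 0 < ε) {x : ℝ} (hx : 1 < x) : ∃ k : ℕ, F x (k + 1) < ε := by
  have hl := Real.log_pos hx
  obtain ⟨k, hk⟩ := exists_nat_gt (1 / (ε * Real.log x))
  refine ⟨k, (F_le (by omega) hx).trans_lt ?_⟩
  have h1 := (sum_pow_ge (by omega : 1 ≤ k + 1) hx.le).2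
  push_cast at h1
  have h2 : 0 < ∑ j ∈ Finset.Icc 1 (k + 1), x ^ j := lt_of_lt_of_le (by positivity) h1
  rw [div_lt_iff₀ (by positivity)] at hk ⊢
  have : (k : ℝ) * (ε * Real.log x) ≤
      (∑ j ∈ Finset.Icc 1 (k + 1), x ^ j) * (ε * Real.log x) := by
    gcongr
    linarith
  linarith

/-- Since `F(p, ·)` decreases strictly, the exponent of `p` counts the `k` with `ε ≤ F(p, k)`. This
replaces the definition through the `x_k` from here on. -/
theorem le_caExponent_iff {ε : ℝ} (hε : 0 < ε) {p : ℕ} (hp : p.Prime) {k : ℕ} (hk : 1 ≤ k) :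
    k ≤ caExponent ε p ↔ ε ≤ F (p : ℝ) k := by
  classical
  have hp1 : (1 : ℝ) < p := by exact_mod_cast hp.one_lt
  have hex := exists_F_lt hε hp1
  set m := Nat.find hex with hm
  have hle : ∀ j, 1 ≤ j → (j ≤ m ↔ ε ≤ F (p : ℝ) j) := fun j hj => by
    constructor
    · intro h
      have := Nat.find_min hex (m := j - 1) (by omega)
      rw [Nat.sub_add_cancel hj] at this
      exact not_lt.1 this
    · intro h
      by_contra hcon
      have h1 := Nat.find_spec hex
      have h2 := F_le_of_le (by omega : 1 ≤ m + 1) (by omega : m + 1 ≤ j) hp1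
      rw [← hm] at h1
      linarith
  have hset : {k : ℕ | 1 ≤ k ∧ critX ε (k + 1) < (p : ℝ) ∧ (p : ℝ) ≤ critX ε k} =
      {k | 1 ≤ k ∧ k = m} := by
    ext j
    refine and_congr_right fun hj => ?_
    rw [le_critX_iff hε hj hp1, ← not_le, le_critX_iff hε (by omega) hp1, ← hle j hj,
      ← hle (j + 1) (by omega)]
    omega
  have hca : caExponent ε p = m := by
    rw [caExponent, hset]
    rcases Nat.eq_zero_or_pos m with h | h
    -- The default `sSup ∅ = 0` in `ℕ` is the exponent wanted here.
    · have : {k : ℕ | 1 ≤ k ∧ k = m} = ∅ := by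
        ext j
        simp only [Set.mem_ofPred_eq, Set.mem_empty_iff_false, iff_false]
        omega
      rw [this, h]
      simp
    · have : {k : ℕ | 1 ≤ k ∧ k = m} = {m} := by
        ext j
        simp only [Set.mem_ofPred_eq, Set.mem_singleton_iff]
        omega
      rw [this, csSup_singleton]
  rw [hca, hle k hk]

theorem exists_caExponent_eq_zero {ε : ℝ} (hε : 0 < ε) :
    ∃ B : ℕ, ∀ p : ℕ, p.Prime → B ≤ p → caExponent ε p = 0 := by
  refine ⟨⌈critX ε 1⌉₊ + 1, fun p hp hB => ?_⟩
  by_contra h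
  have h1 := (le_caExponent_iff hε hp le_rfl).1 (by omega)
  rw [← le_critX_iff hε le_rfl (by exact_mod_cast hp.one_lt)] at h1
  have h2 : (p : ℝ) ≤ ⌈critX ε 1⌉₊ := h1.trans (Nat.le_ceil _)
  have : p ≤ ⌈critX ε 1⌉₊ := by exact_mod_cast h2
  omega

theorem caOfEps_eq_prod {ε : ℝ} {B : ℕ}
    (hB : ∀ p : ℕ, p.Prime → B ≤ p → caExponent ε p = 0) :
    caOfEps ε = ∏ p ∈ (Finset.range B).filter Nat.Prime, p ^ caExponent ε p := by
  rw [caOfEps, Finset.prod_filter, ← finprod_eq_prod_of_mulSupport_subset]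
  · refine finprod_congr fun p => ?_
    by_cases hp : p.Prime
    · simp [hp]
    · simp [hp]
  · intro p hp
    rw [Function.mem_mulSupport] at hp
    by_contra h
    refine hp ?_
    split_ifs with hpp
    · rw [hB p hpp (by simpa using h), pow_zero]
    · rfl

theorem critEps_succ_lt {i : ℕ} (hi : 1 ≤ i) : critEps (i + 1) < critEps i := by
  obtain ⟨h1, h2⟩ := critEps_spec hi
  obtain ⟨h3, h4⟩ := critEps_spec (i := i + 1) (by omega)
  by_contra hcon
  have hs : {e' : ℝ | e' ∈ critSet ∧ critEps (i + 1) ≤ e'} ⊆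
      {e' : ℝ | e' ∈ critSet ∧ critEps i ≤ e'} := fun x hx => ⟨hx.1, (not_lt.1 hcon).trans hx.2⟩
  have := Set.encard_le_encard hs
  rw [h2, h4, Nat.cast_le] at this
  omega

/-- The elements of `E` from `ε_{i+1}` up number one more than those from `ε_i` up, so nothing in
`E` lies strictly between the two. -/
theorem critEps_succ_le_iff {i : ℕ} (hi : 1 ≤ i) {e : ℝ} (he : e ∈ critSet) :
    critEps (i + 1) ≤ e ↔ critEps (i + 1) = e ∨ critEps i ≤ e := by
  obtain ⟨h1, h2⟩ := critEps_spec hi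
  obtain ⟨h3, h4⟩ := critEps_spec (i := i + 1) (by omega)
  have hlt := critEps_succ_lt hi
  have hs : insert (critEps (i + 1)) {e' : ℝ | e' ∈ critSet ∧ critEps i ≤ e'} =
      {e' : ℝ | e' ∈ critSet ∧ critEps (i + 1) ≤ e'} := by
    refine Set.Finite.eq_of_subset_of_encard_le
      (((critSet_finite (critSet_pos h1))).insert _) ?_ ?_
    · rintro x (rfl | hx)
      · exact ⟨h3, le_rfl⟩
      · exact ⟨hx.1, hlt.le.trans hx.2⟩
    · rw [h4, Set.encard_insert_of_notMem fun h => absurd h.2 (not_le.2 hlt), h2]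
      push_cast
      exact le_rfl
  constructor
  · intro h
    have : e ∈ insert (critEps (i + 1)) {e' : ℝ | e' ∈ critSet ∧ critEps i ≤ e'} := by
      rw [hs]
      exact ⟨he, h⟩
    rcases this with h | h
    · exact Or.inl h.symm
    · exact Or.inr h.2
  · rintro (h | h)
    · exact h.le
    · exact hlt.le.trans h

/-- The prime `p` represents `ε` when `ε = F(p, k)` for some `k ≥ 1`. -/
def Represents (p : ℕ) (ε : ℝ) : Prop := p.Prime ∧ ∃ k : ℕ, 1 ≤ k ∧ ε = F (p : ℝ) k

/-- Lowering the threshold to `ε_{i+1}` newly admits only the `k` with `F(p, k) = ε_{i+1}`, and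
strict monotonicity in `k` leaves just one. -/
theorem caExponent_critEps_succ_of_represents {i : ℕ} (hi : 1 ≤ i) {p : ℕ}
    (h : Represents p (critEps (i + 1))) :
    caExponent (critEps (i + 1)) p = caExponent (critEps i) p + 1 ∧
      critEps (i + 1) = F (p : ℝ) (caExponent (critEps i) p + 1) := by
  obtain ⟨hp, k, hk, hkε⟩ := h
  have hp1 : (1 : ℝ) < p := by exact_mod_cast hp.one_lt
  have hε := critSet_pos (critEps_spec hi).1
  have hε' := critSet_pos (critEps_spec (i := i + 1) (by omega)).1
  have key : ∀ j, 1 ≤ j → (j ≤ caExponent (critEps (i + 1)) p ↔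
      critEps (i + 1) = F (p : ℝ) j ∨ j ≤ caExponent (critEps i) p) := fun j hj => by
    rw [le_caExponent_iff hε hp hj, le_caExponent_iff hε' hp hj,
      critEps_succ_le_iff hi ⟨p, j, hp, hj, rfl⟩]
  have h1 : ¬ k ≤ caExponent (critEps i) p := by
    rw [le_caExponent_iff hε hp hk, ← hkε, not_le]
    exact critEps_succ_lt hi
  have h2 := (key k hk).2 (Or.inl hkε)
  have h3 := ((key (caExponent (critEps i) p + 1) (by omega)).1 (by omega)).resolve_right
    (by omega)
  have h4 := ((key (caExponent (critEps (i + 1)) p) (by omega)).1 le_rfl).resolve_right (by omega)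
  exact ⟨F_inj (by omega) (by omega) hp1 (h4.symm.trans h3), h3⟩

theorem caExponent_critEps_succ_of_not_represents {i : ℕ} (hi : 1 ≤ i) {p : ℕ} (hp : p.Prime)
    (h : ¬ Represents p (critEps (i + 1))) :
    caExponent (critEps (i + 1)) p = caExponent (critEps i) p := by
  have hε := critSet_pos (critEps_spec hi).1
  have hε' := critSet_pos (critEps_spec (i := i + 1) (by omega)).1
  refine eq_of_forall_le_iff fun j => ?_
  rcases Nat.eq_zero_or_pos j with rfl | hj
  · simp
  rw [le_caExponent_iff hε hp hj, le_caExponent_iff hε' hp hj,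
    critEps_succ_le_iff hi ⟨p, j, hp, hj, rfl⟩]
  exact or_iff_right fun h' => h ⟨hp, j, hj, h'⟩

theorem rho_prod_prime_pow {s : Finset ℕ} (hs : ∀ p ∈ s, p.Prime) (e : ℕ → ℕ) :
    rho (∏ p ∈ s, p ^ e p) = ∏ p ∈ s, rho (p ^ e p) := by
  simp only [rho]
  rw [ArithmeticFunction.isMultiplicative_sigma.map_prod (fun p => p ^ e p) s, Nat.cast_prod,
    Nat.cast_prod, Finset.prod_div_distrib]
  intro p hp q hq hpq
  exact Nat.Coprime.pow _ _ ((Nat.coprime_primes (hs p hp) (hs q hq)).2 hpq)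

theorem exp_F_mul_log {k : ℕ} (hk : 1 ≤ k) {x : ℝ} (hx : 1 < x) :
    Real.exp (F x k * Real.log x) = 1 + 1 / ∑ j ∈ Finset.Icc 1 k, x ^ j := by
  have hA0 : 0 < ∑ j ∈ Finset.Icc 1 k, x ^ j := by linarith [(sum_pow_ge hk hx.le).1]
  rw [F, div_mul_cancel₀ _ (Real.log_pos hx).ne', Real.exp_log (by positivity)]

/-- This is the reason for the form of `F`: `p ^ F(p, k + 1)` is exactly the gain in `ρ` from one
more factor `p`. -/
theorem rho_prime_pow_succ {p : ℕ} (hp : p.Prime) (k : ℕ) :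
    rho (p ^ (k + 1)) = rho (p ^ k) * Real.exp (F (p : ℝ) (k + 1) * Real.log p) := by
  have hp1 : (1 : ℝ) < p := by exact_mod_cast hp.one_lt
  rw [exp_F_mul_log (by omega) hp1, rho, rho, ArithmeticFunction.sigma_one_apply_prime_pow hp,
    ArithmeticFunction.sigma_one_apply_prime_pow hp, Finset.sum_range_succ']
  have h1 : ∑ j ∈ Finset.Icc 1 (k + 1), (p : ℝ) ^ j = p * ∑ j ∈ Finset.range (k + 1), (p : ℝ) ^ j := by
    rw [Finset.mul_sum, ← Finset.Ico_add_one_right_eq_Icc, Finset.sum_Ico_eq_sum_range]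
    refine Finset.sum_congr rfl fun j _ => ?_
    ring
  have h2 : 0 < ∑ j ∈ Finset.range (k + 1), (p : ℝ) ^ j :=
    Finset.sum_pos (fun j _ => by positivity) ⟨0, by simp⟩
  rw [h1]
  push_cast
  simp only [pow_succ, ← Finset.sum_mul]
  field_simp

/-- Passing from `n_i` to `n_{i+1}` multiplies by all primes that represent `ε_{i+1}`. -/
theorem exists_representing_primes {i : ℕ} (hi : 1 ≤ i) : ∃ R : Finset ℕ,
    (∀ r, r ∈ R ↔ Represents r (critEps (i + 1))) ∧
    caSeq (i + 1) = caSeq i * ∏ r ∈ R, r ∧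
    rho (caSeq (i + 1)) =
      rho (caSeq i) * Real.exp (critEps (i + 1) * Real.log (∏ r ∈ R, r : ℕ)) := by
  classical
  have hε := critSet_pos (critEps_spec hi).1
  have hε' := critSet_pos (critEps_spec (i := i + 1) (by omega)).1
  obtain ⟨B₁, hB₁⟩ := exists_caExponent_eq_zero hε
  obtain ⟨B₂, hB₂⟩ := exists_caExponent_eq_zero hε'
  set B := max B₁ B₂ with hB
  set S := (Finset.range B).filter Nat.Prime with hS
  have hSp : ∀ p ∈ S, p.Prime := fun p hp => (Finset.mem_filter.1 hp).2
  have e1 : caSeq i = ∏ p ∈ S, p ^ caExponent (critEps i) p :=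
    caOfEps_eq_prod fun p hp h => hB₁ p hp ((le_max_left _ _).trans h)
  have e2 : caSeq (i + 1) = ∏ p ∈ S, p ^ caExponent (critEps (i + 1)) p :=
    caOfEps_eq_prod fun p hp h => hB₂ p hp ((le_max_right _ _).trans h)
  set R := S.filter fun p => Represents p (critEps (i + 1)) with hR
  refine ⟨R, fun r => ?_, ?_, ?_⟩
  · refine ⟨fun h => (Finset.mem_filter.1 h).2, fun h => ?_⟩
    refine Finset.mem_filter.2 ⟨Finset.mem_filter.2 ⟨?_, h.1⟩, h⟩
    by_contra hr
    have h1 := (caExponent_critEps_succ_of_represents hi h).1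
    rw [hB₂ r h.1 ((le_max_right _ _).trans (not_lt.1 fun h => hr (Finset.mem_range.2 h)))] at h1
    omega
  · rw [e1, e2, hR, Finset.prod_filter _ (s := S), ← Finset.prod_mul_distrib]
    refine Finset.prod_congr rfl fun p hp => ?_
    split_ifs with h
    · rw [(caExponent_critEps_succ_of_represents hi h).1, pow_succ]
    · rw [caExponent_critEps_succ_of_not_represents hi (hSp p hp) h, mul_one]
  · rw [Nat.cast_prod, Real.log_prod fun r hr => by
      exact_mod_cast (hSp r (Finset.mem_filter.1 hr).1).ne_zero, Finset.mul_sum, Real.exp_sum,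
      e1, e2, rho_prod_prime_pow hSp, rho_prod_prime_pow hSp, hR, Finset.prod_filter _ (s := S),
      ← Finset.prod_mul_distrib]
    refine Finset.prod_congr rfl fun p hp => ?_
    split_ifs with h
    · obtain ⟨h1, h2⟩ := caExponent_critEps_succ_of_represents hi h
      rw [h1, rho_prime_pow_succ (hSp p hp), ← h2]
    · rw [caExponent_critEps_succ_of_not_represents hi (hSp p hp) h, mul_one]

theorem caSeq_pos {i : ℕ} (hi : 1 ≤ i) : 0 < caSeq i := by
  obtain ⟨B, hB⟩ := exists_caExponent_eq_zero (critSet_pos (critEps_spec hi).1)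
  rw [caSeq, caOfEps_eq_prod hB]
  exact Finset.prod_pos fun p hp => pow_pos (Finset.mem_filter.1 hp).2.pos _

theorem rho_pos {n : ℕ} (hn : 0 < n) : 0 < rho n := by
  have h : 0 < ArithmeticFunction.sigma 1 n := ArithmeticFunction.sigma_pos 1 n hn.ne'
  exact div_pos (by exact_mod_cast h) (by exact_mod_cast hn)

/-- A prime not dividing `n_i` satisfies `F(p, 1) ≤ ε_{i+1}`. -/
theorem F_le_critEps_succ {i : ℕ} (hi : 1 ≤ i) {p : ℕ} (hp : p.Prime) (hpn : ¬ p ∣ caSeq i) :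
    F (p : ℝ) 1 ≤ critEps (i + 1) := by
  have hε := critSet_pos (critEps_spec hi).1
  -- Otherwise `F(p, 1)` would be at least `ε_i`, giving `p` a positive exponent in `n_i`.
  by_contra hcon
  have h1 := ((critEps_succ_le_iff hi ⟨p, 1, hp, le_rfl, rfl⟩).1 (not_le.1 hcon).le).resolve_left
    (not_le.1 hcon).ne
  rw [← le_caExponent_iff hε hp le_rfl] at h1
  obtain ⟨B, hB⟩ := exists_caExponent_eq_zero hε
  refine hpn ?_
  rw [caSeq, caOfEps_eq_prod hB]
  refine (dvd_pow_self p (by omega : caExponent (critEps i) p ≠ 0)).trans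
    (Finset.dvd_prod_of_mem (fun p => p ^ caExponent (critEps i) p)
      (Finset.mem_filter.2 ⟨Finset.mem_range.2 ?_, hp⟩))
  by_contra h
  have := hB p hp (not_lt.1 h)
  omega

theorem nextPrime_spec (m : ℕ) : (nextPrime m).Prime ∧ m < nextPrime m := by
  obtain ⟨p, h1, h2⟩ := Nat.exists_infinite_primes (m + 1)
  exact Nat.sInf_mem (s := {p : ℕ | p.Prime ∧ m < p}) ⟨p, h2, h1⟩

theorem nextPrime_largestPrime_not_dvd {n : ℕ} (hn : 0 < n) :
    ¬ nextPrime (largestPrime n) ∣ n := fun h => by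
  obtain ⟨h1, h2⟩ := nextPrime_spec (largestPrime n)
  have hb : BddAbove {p : ℕ | p.Prime ∧ p ∣ n} := ⟨n, fun p hp => Nat.le_of_dvd hn hp.2⟩
  exact absurd (le_csSup hb ⟨h1, h⟩) (not_le.2 h2)

/-! ### How many primes can represent a critical parameter -/

/-- If `F(p, k) = m / b`, then `(1 + 1 / S) ^ b = p ^ m` with `S = p + ⋯ + p ^ k`. A rational root
of an integer is an integer, but `1 + 1 / S` lies strictly between `1` and `2`. -/
theorem irrational_F {p k : ℕ} (hp : p.Prime) (hk : 1 ≤ k) : Irrational (F (p : ℝ) k) := by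
  have hp1 : (1 : ℝ) < p := by exact_mod_cast hp.one_lt
  have hp2 : (2 : ℝ) ≤ p := by exact_mod_cast hp.two_le
  have hS := (sum_pow_ge hk hp1.le).1
  set S : ℝ := ∑ j ∈ Finset.Icc 1 k, (p : ℝ) ^ j with hSdef
  have hS0 : 0 < 1 / S := one_div_pos.2 (by linarith)
  have hS1 : 1 / S < 1 := by rw [div_lt_one (by linarith)]; linarith
  rintro ⟨a, ha⟩
  have ha0 : 0 < a := by
    have := F_pos hk hp1
    rw [← ha] at this
    exact_mod_cast this
  obtain ⟨m, hm⟩ := Int.eq_ofNat_of_zero_le (Rat.num_nonneg.2 ha0.le)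
  have h1 : (1 + 1 / S) ^ a.den = ((p ^ m : ℕ) : ℤ) := by
    rw [← exp_F_mul_log hk hp1, ← Real.exp_nat_mul, ← ha, ← mul_assoc]
    have h2 : (a.den : ℝ) * a = m := by
      have := Rat.den_mul_eq_num a
      rw [hm] at this
      exact_mod_cast this
    rw [h2, Real.exp_nat_mul, Real.exp_log (by linarith)]
    push_cast
    rfl
  refine irrational_nrt_of_notint_nrt _ _ h1 ?_ a.den_pos ⟨1 + 1 / ∑ j ∈ Finset.Icc 1 k, (p : ℚ) ^ j, ?_⟩
  · rintro ⟨y, hy⟩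
    have h2 : (1 : ℝ) < y := by linarith
    have h3 : (y : ℝ) < 2 := by linarith
    have h4 : 1 < y := by exact_mod_cast h2
    have h5 : y < 2 := by exact_mod_cast h3
    omega
  · rw [hSdef]
    push_cast
    rfl

/-- At most two primes represent a critical parameter. -/
theorem card_le_two_of_represents {ε : ℝ} {R : Finset ℕ} (hR : ∀ r ∈ R, Represents r ε) :
    R.card ≤ 2 := by
  by_contra hcon
  have h3 : 3 ≤ R.card := by omega
  set P : Fin 3 → ℕ := fun j => R.orderEmbOfFin rfl (Fin.castLE h3 j) with hP
  have hPR : ∀ j, Represents (P j) ε := fun j => hR _ (Finset.orderEmbOfFin_mem _ _ _)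
  have hinj : Function.Injective P := fun a b hab => by
    simpa using (R.orderEmbOfFin rfl).injective hab
  have key : ∀ j, (P j : ℝ) ^ ε ≤ 2 ∧ ∃ a : ℚ, (P j : ℝ) ^ ε = a := fun j => by
    obtain ⟨hp, k, hk, rfl⟩ := hPR j
    have hp1 : (1 : ℝ) < P j := by exact_mod_cast hp.one_lt
    have hS := (sum_pow_ge hk hp1.le).1
    rw [Real.rpow_def_of_pos (by linarith), mul_comm, exp_F_mul_log hk hp1]
    refine ⟨?_, 1 + 1 / ∑ j' ∈ Finset.Icc 1 k, (P j : ℚ) ^ j', ?_⟩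
    · have : 1 / ∑ j' ∈ Finset.Icc 1 k, (P j : ℝ) ^ j' ≤ 1 := by
        rw [div_le_one (by linarith)]
        linarith
      linarith
    · push_cast
      rfl
  have hε : Irrational ε := by
    obtain ⟨hp, k, hk, rfl⟩ := hPR 0
    exact irrational_F hp hk
  have hε0 : 0 < ε := by
    obtain ⟨hp, k, hk, h⟩ := hPR 0
    exact critSet_pos ⟨_, k, hp, hk, h⟩
  -- A prime representing `ε` satisfies `p ^ ε ≤ 2 ≤ p`.
  have hε1 : ε ≤ 1 := by
    by_contra hcon
    have hp := (hPR 0).1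
    have hp1 : (1 : ℝ) < P 0 := by exact_mod_cast hp.one_lt
    have hp2 : (2 : ℝ) ≤ P 0 := by exact_mod_cast hp.two_le
    have := Real.rpow_lt_rpow_of_exponent_lt hp1 (not_le.1 hcon)
    rw [Real.rpow_one] at this
    linarith [(key 0).1]
  exact not_rational_rpow_three_primes (fun j => (hPR j).1) hinj hε hε0.le hε1 fun j => (key j).2

end CANumbers

/-! ### Real inequalities comparing the growth of `ρ` and of `log log` -/

theorem log_one_add_le_cubic {x : ℝ} (hx : 0 ≤ x) :
    Real.log (1 + x) ≤ x - x ^ 2 / 2 + x ^ 3 / 3 := by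
  have hder : ∀ y : ℝ, 0 ≤ y → HasDerivAt
      (fun y => y - y ^ 2 / 2 + y ^ 3 / 3 - Real.log (1 + y)) (y ^ 3 / (1 + y)) y := fun y hy => by
    have h1 : HasDerivAt (fun y : ℝ => 1 + y) 1 y := (hasDerivAt_id y).const_add 1
    have h2 := (((hasDerivAt_id y).sub ((hasDerivAt_pow 2 y).div_const 2)).add
      ((hasDerivAt_pow 3 y).div_const 3)).sub (h1.log (by linarith))
    refine h2.congr_deriv ?_
    have : 1 + y ≠ 0 := by linarith
    field_simp
    push_cast
    ring
  have hmono : MonotoneOn (fun y : ℝ => y - y ^ 2 / 2 + y ^ 3 / 3 - Real.log (1 + y))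
      (Set.Ici 0) := by
    refine monotoneOn_of_deriv_nonneg (convex_Ici 0)
      (fun y hy => (hder y hy).continuousAt.continuousWithinAt)
      (fun y hy => (hder y (interior_subset hy)).differentiableAt.differentiableWithinAt)
      fun y hy => ?_
    have hy0 : 0 ≤ y := interior_subset hy
    rw [(hder y hy0).deriv]
    positivity
  have := hmono (Set.self_mem_Ici) hx hx
  norm_num at this
  linarith

theorem sub_sq_div_two_le_log_one_add {x : ℝ} (hx : 0 ≤ x) :
    x - x ^ 2 / 2 ≤ Real.log (1 + x) := by
  refine le_trans ?_ (Real.le_log_one_add_of_nonneg hx)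
  rw [le_div_iff₀ (by linarith)]
  nlinarith [pow_nonneg hx 3]

/-- This is how CA3 enters: with `N = log n_i`, the inequality `p < N` lets `p` replace `N`. -/
theorem log_one_add_div_div_log_lt {p N L : ℝ} (hp : 1 < p) (hN : p < N) (hL : 0 < L) :
    Real.log (1 + L / N) / Real.log N < Real.log (1 + L / p) / Real.log p := by
  have h1 : L / N < L / p := div_lt_div_of_pos_left hL (by linarith) hN
  have h0 : 0 < L / N := div_pos hL (by linarith)
  exact div_lt_div₀ (Real.log_lt_log (by linarith) (by linarith))
    (Real.log_le_log (by linarith) hN.le) (Real.log_nonneg (by linarith)) (Real.log_pos hp)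

/-- Bernoulli gives `log (1 + L / p) ≤ L log (1 + 1 / p)` for `L ≥ 1`; then `1 + x ≤ exp x` at `x =
ε L`. -/
theorem one_add_log_div_log_lt_exp {p N L ε : ℝ} (hp : 1 < p) (hN : p < N) (hL : 1 ≤ L)
    (hε : Real.log (1 + 1 / p) / Real.log p ≤ ε) :
    1 + Real.log (1 + L / N) / Real.log N < Real.exp (ε * L) := by
  have h1 := log_one_add_div_div_log_lt hp hN (by linarith : 0 < L)
  have hlp := Real.log_pos hp
  have hp0 : 0 < 1 / p := by positivity
  have h2 : Real.log (1 + L / p) ≤ L * Real.log (1 + 1 / p) := by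
    rw [← Real.log_rpow (by positivity)]
    refine Real.log_le_log (by positivity) ?_
    have := one_add_mul_self_le_rpow_one_add (by linarith : -1 ≤ 1 / p) hL
    rwa [mul_one_div] at this
  have h3 : Real.log (1 + L / p) / Real.log p ≤ ε * L := by
    refine le_trans ?_ (mul_le_mul_of_nonneg_right hε (by linarith))
    rw [div_mul_eq_mul_div]
    gcongr
    linarith
  linarith [Real.add_one_le_exp (ε * L)]

/-- Writing `log p = log 23 + 2 log s` with `s = √(p / 23)` and using `log s ≤ s - 1` turns later
estimates into polynomial ones in `s ≥ 1`. -/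
theorem log_le_mul_sqrt {p : ℝ} (hp : 23 ≤ p) :
    Real.log p ≤ 16 / 5 * Real.sqrt (p / 23) ∧ 1 ≤ Real.sqrt (p / 23) := by
  have hs1 : 1 ≤ Real.sqrt (p / 23) := by
    rw [Real.one_le_sqrt, le_div_iff₀ (by norm_num)]
    linarith
  have hlog23 : Real.log 23 ≤ 16 / 5 := by
    rw [Real.log_le_iff_le_exp (by norm_num)]
    have h1 : (2.7182818283 : ℝ) < Real.exp 1 := Real.exp_one_gt_d9
    have h2 := Real.add_one_le_exp (1 / 5 : ℝ)
    have h3 : Real.exp (16 / 5) = Real.exp 1 ^ 3 * Real.exp (1 / 5) := by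
      rw [← Real.exp_nat_mul, ← Real.exp_add]
      norm_num
    rw [h3]
    calc (23 : ℝ) ≤ 2.7182818283 ^ 3 * (1 / 5 + 1) := by norm_num
      _ ≤ _ := by gcongr
  refine ⟨?_, hs1⟩
  have h1 : Real.log p = Real.log 23 + 2 * Real.log (Real.sqrt (p / 23)) := by
    rw [Real.log_sqrt (by positivity), Real.log_div (by linarith) (by norm_num)]
    ring
  have h2 := Real.log_le_sub_one_of_pos (by linarith : 0 < Real.sqrt (p / 23))
  linarith

/-- Put `u = L / (p log p)`. To leading order the left side is at most `1 + u (1 - L / (2 p))`, the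
exponential is at least `1 + u (1 - 1 / (2 p))`, and the loss is `u L / (3 p)`. It fits when `L / 3
≤ (L - 1) / 2`, that is `L ≥ 3`. -/
theorem one_add_log_div_log_lt_exp_mul {p N L ε : ℝ} (hp : 23 ≤ p) (hN : p < N) (hL : 3 ≤ L)
    (hLp : L ≤ 2 * Real.log p) (hε : Real.log (1 + 1 / p) / Real.log p ≤ ε) :
    1 + Real.log (1 + L / N) / Real.log N <
      Real.exp (ε * L) * (1 - L ^ 2 / (3 * p ^ 2 * Real.log p)) := by
  have hb := log_one_add_div_div_log_lt (by linarith : 1 < p) hN (by linarith : 0 < L)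
  obtain ⟨hl1, hs1⟩ := log_le_mul_sqrt hp
  set s := Real.sqrt (p / 23) with hs
  have hs2 : p = 23 * s ^ 2 := by rw [hs, Real.sq_sqrt (by positivity)]; ring
  set l := Real.log p with hl
  have hl0 : 0 < l := Real.log_pos (by linarith)
  have hp0 : 0 < p := by linarith
  -- This lets the quadratic term of the exponential absorb the cubic term of the logarithm and the
  -- cross terms, using `L ≤ 2 log p`.
  have hmain : 2 * l ^ 2 / 3 + 7 / 10 * l ≤ (p - 1) / 2 := by nlinarith
  set u := L / (p * l) with hu
  have hu0 : 0 < u := by positivity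
  have hu2 : u ≤ 2 / p := by
    rw [hu, div_le_div_iff₀ (by positivity) hp0]
    nlinarith
  have hu3 : u ≤ 1 / 10 := hu2.trans (by rw [div_le_div_iff₀ hp0 (by norm_num)]; linarith)
  set a := u * (1 - 1 / (2 * p)) with ha
  have hp2 : 1 / (2 * p) ≤ 1 / 2 := by
    rw [div_le_div_iff₀ (by positivity) (by norm_num)]
    linarith
  have hp20 : 0 < 1 / (2 * p) := by positivity
  have ha0 : 0 ≤ a := mul_nonneg hu0.le (by linarith)
  have hau : a ≤ u := mul_le_of_le_one_right hu0.le (by linarith)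
  have haε : a ≤ ε * L := by
    refine le_trans ?_ (mul_le_mul_of_nonneg_right hε (by linarith))
    have h := sub_sq_div_two_le_log_one_add (by positivity : 0 ≤ 1 / p)
    calc a = (1 / p - (1 / p) ^ 2 / 2) / l * L := by rw [ha, hu]; field_simp
      _ ≤ _ := by gcongr
  have hbu : Real.log (1 + L / p) / l ≤ u * (1 - L / (2 * p) + L ^ 2 / (3 * p ^ 2)) := by
    have h := log_one_add_le_cubic (by positivity : 0 ≤ L / p)
    calc Real.log (1 + L / p) / l ≤ (L / p - (L / p) ^ 2 / 2 + (L / p) ^ 3 / 3) / l := by gcongr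
      _ = _ := by rw [hu]; field_simp
  have hδ : L ^ 2 / (3 * p ^ 2 * l) = u * (L / (3 * p)) := by rw [hu]; field_simp
  have hδ1 : u * (L / (3 * p)) ≤ 1 := by
    have : L / (3 * p) ≤ 1 := by
      rw [div_le_one (by positivity)]
      nlinarith
    exact mul_le_one₀ (hu3.trans (by norm_num)) (by positivity) this
  have hexp : 1 + a + a ^ 2 / 2 ≤ Real.exp (ε * L) :=
    (Real.quadratic_le_exp_of_nonneg ha0).trans (Real.exp_le_exp.2 haε)
  have hkey : L / (3 * p) * (1 + 21 / 20 * u) ≤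
      (L - 1) / (2 * p) - L ^ 2 / (3 * p ^ 2) + u * (1 - 1 / p) / 2 := by
    have h1 : L / (3 * p) ≤ (L - 1) / (2 * p) := by
      rw [div_le_div_iff₀ (by positivity) (by positivity)]
      nlinarith
    have h2 : L / (3 * p) * (21 / 20 * u) + L ^ 2 / (3 * p ^ 2) ≤ u * (1 - 1 / p) / 2 := by
      have e1 : L / (3 * p) * (21 / 20 * u) + L ^ 2 / (3 * p ^ 2) =
          u / p * (7 / 20 * L + L * l / 3) := by rw [hu]; field_simp; ring
      have e2 : u * (1 - 1 / p) / 2 = u / p * ((p - 1) / 2) := by field_simp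
      rw [e1, e2]
      refine mul_le_mul_of_nonneg_left ?_ (by positivity)
      linarith [mul_le_mul_of_nonneg_right hLp hl0.le]
    linarith
  have ha2 : u ^ 2 * (1 - 1 / p) / 2 ≤ a ^ 2 / 2 := by
    have : (1 - 1 / p) ≤ (1 - 1 / (2 * p)) ^ 2 := by
      have : (1 - 1 / (2 * p)) ^ 2 = 1 - 1 / p + (1 / (2 * p)) ^ 2 := by field_simp; ring
      rw [this]
      linarith [sq_nonneg (1 / (2 * p))]
    rw [ha, mul_pow]
    have := mul_le_mul_of_nonneg_left this (sq_nonneg u)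
    linarith
  have hab : u * ((L - 1) / (2 * p) - L ^ 2 / (3 * p ^ 2)) =
      a - u * (1 - L / (2 * p) + L ^ 2 / (3 * p ^ 2)) := by
    rw [ha]; field_simp; ring
  have ha3 : 1 + a + a ^ 2 / 2 ≤ 1 + 21 / 20 * u := by
    have : a ^ 2 ≤ u * (1 / 10) := by
      rw [sq]
      exact mul_le_mul hau (hau.trans hu3) ha0 hu0.le
    linarith
  have hfin : u * (L / (3 * p)) * (1 + a + a ^ 2 / 2) ≤
      a - u * (1 - L / (2 * p) + L ^ 2 / (3 * p ^ 2)) + a ^ 2 / 2 := by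
    calc u * (L / (3 * p)) * (1 + a + a ^ 2 / 2) ≤ u * (L / (3 * p)) * (1 + 21 / 20 * u) := by
          gcongr
      _ = u * (L / (3 * p) * (1 + 21 / 20 * u)) := by ring
      _ ≤ u * ((L - 1) / (2 * p) - L ^ 2 / (3 * p ^ 2) + u * (1 - 1 / p) / 2) := by gcongr
      _ ≤ _ := by linarith
  rw [hδ]
  calc 1 + Real.log (1 + L / N) / Real.log N < 1 + Real.log (1 + L / p) / l := by linarith
    _ ≤ (1 + a + a ^ 2 / 2) * (1 - u * (L / (3 * p))) := by linarith
    _ ≤ _ := mul_le_mul_of_nonneg_right hexp (by linarith)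

/-! ### Comparison of `G` at consecutive colossally abundant numbers -/

namespace CANumbers

theorem G_lt_G_mul_mul {n Q : ℕ} {ε c : ℝ} (hn : 1 < Real.log n) (hQ : 0 < Q)
    (hrho : rho (n * Q) = rho n * Real.exp (ε * Real.log Q))
    (h : 1 + Real.log (1 + Real.log Q / Real.log n) / Real.log (Real.log n) <
      Real.exp (ε * Real.log Q) * c) :
    G n < G (n * Q) * c := by
  have hn0 : 0 < n := Nat.pos_of_ne_zero fun h0 => by
    rw [h0] at hn
    norm_num at hn
  have hρ := rho_pos hn0
  have hll := Real.log_pos hn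
  have hL : 0 ≤ Real.log Q := Real.log_natCast_nonneg Q
  have h1 : 0 < 1 + Real.log Q / Real.log n := by positivity
  have h2 : 0 ≤ Real.log (1 + Real.log Q / Real.log n) :=
    Real.log_nonneg (le_add_of_nonneg_right (by positivity))
  have h3 : Real.log (Real.log ((n * Q : ℕ) : ℝ)) = Real.log (Real.log n) *
      (1 + Real.log (1 + Real.log Q / Real.log n) / Real.log (Real.log n)) := by
    rw [Nat.cast_mul, Real.log_mul (by positivity) (by positivity), mul_add, mul_one,
      mul_div_cancel₀ _ hll.ne', ← Real.log_mul (by positivity) h1.ne']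
    congr 1
    field_simp
  have h4 : 0 < 1 + Real.log (1 + Real.log Q / Real.log n) / Real.log (Real.log n) := by
    positivity
  rw [G, G, h3, hrho, div_mul_eq_mul_div, div_lt_div_iff₀ hll (by positivity)]
  calc rho n * (Real.log (Real.log n) *
        (1 + Real.log (1 + Real.log Q / Real.log n) / Real.log (Real.log n)))
      < rho n * (Real.log (Real.log n) * (Real.exp (ε * Real.log Q) * c)) := by gcongr
    _ = _ := by ring

/-- For `r > p` one would have `F(r, k) ≤ F(r, 1) < F(p, 1) ≤ ε`. -/
theorem Represents.le_of_F_le {p r : ℕ} {ε : ℝ} (hp : p.Prime) (h : F (p : ℝ) 1 ≤ ε)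
    (hr : Represents r ε) : r ≤ p := by
  obtain ⟨hr, k, hk, rfl⟩ := hr
  by_contra hcon
  have h1 := F_lt_F le_rfl (by exact_mod_cast hp.one_lt : (1 : ℝ) < p)
    (by exact_mod_cast not_le.1 hcon : (p : ℝ) < r)
  have h2 := F_le_of_le le_rfl hk (by exact_mod_cast hr.one_lt : (1 : ℝ) < r)
  linarith

theorem log_prod_le {R : Finset ℕ} {p : ℕ} (hp : 0 < p) (hR : ∀ r ∈ R, 0 < r ∧ r ≤ p)
    (hcard : R.card ≤ 2) : Real.log (∏ r ∈ R, r : ℕ) ≤ 2 * Real.log p := by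
  have h1 : ∏ r ∈ R, r ≤ p ^ 2 :=
    (Finset.prod_le_pow_card R _ p fun r hr => (hR r hr).2).trans (Nat.pow_le_pow_right hp hcard)
  have h2 : 0 < ∏ r ∈ R, r := Finset.prod_pos fun r hr => (hR r hr).1
  calc Real.log (∏ r ∈ R, r : ℕ) ≤ Real.log ((p : ℝ) ^ 2) :=
        Real.log_le_log (by exact_mod_cast h2) (by exact_mod_cast h1)
    _ = 2 * Real.log p := by rw [Real.log_pow]; norm_num

theorem three_le_log {q : ℕ} (hq : 23 ≤ q) : 3 ≤ Real.log q := by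
  have hq' : (23 : ℝ) ≤ q := by exact_mod_cast hq
  rw [Real.le_log_iff_exp_le (by linarith)]
  have h1 : Real.exp 3 = Real.exp 1 ^ 3 := by
    rw [← Real.exp_nat_mul]
    norm_num
  rw [h1]
  calc Real.exp 1 ^ 3 ≤ 2.7182818286 ^ 3 := by
        gcongr
        exact Real.exp_one_lt_d9.le
    _ ≤ 23 := by norm_num
    _ ≤ q := hq'

theorem one_le_log {q : ℕ} (hq : 3 ≤ q) : 1 ≤ Real.log q := by
  have hq' : (3 : ℝ) ≤ q := by exact_mod_cast hq
  rw [Real.le_log_iff_exp_le (by linarith)]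
  linarith [Real.exp_one_lt_d9]

end CANumbers

open CANumbers
theorem theorem3 (i : ℕ) (hi : 1 ≤ i) (h3 : IsCA3 (caSeq i))
    (p : ℕ) (hp : p = nextPrime (largestPrime (caSeq i))) :
    (∀ q k : ℕ, q.Prime → 1 ≤ k → critEps (i + 1) = F (q : ℝ) k → 3 ≤ q →
      ((∀ r j : ℕ, r.Prime → 1 ≤ j → critEps (i + 1) = F (r : ℝ) j → r = q) →
        caSeq (i + 1) = caSeq i * q) ∧
      G (caSeq i) < G (caSeq (i + 1))) ∧
    (∀ q k : ℕ, q.Prime → 1 ≤ k → critEps (i + 1) = F (q : ℝ) k → 23 ≤ q →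
      ((∀ r j : ℕ, r.Prime → 1 ≤ j → critEps (i + 1) = F (r : ℝ) j → r = q) →
        caSeq (i + 1) = caSeq i * q) ∧
      G (caSeq i) < G (caSeq (i + 1)) *
        (1 - (Real.log q) ^ 2 / (3 * (p : ℝ) ^ 2 * Real.log p))) ∧
    (∀ q k r j : ℕ, q.Prime → 1 ≤ k → r.Prime → 1 ≤ j → q ≠ r →
      critEps (i + 1) = F (q : ℝ) k → critEps (i + 1) = F (r : ℝ) j → 23 ≤ q → 23 ≤ r →
      caSeq (i + 1) = caSeq i * (q * r) ∧
      G (caSeq i) < G (caSeq (i + 1)) *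
        (1 - (Real.log q) ^ 2 / (3 * (p : ℝ) ^ 2 * Real.log p)) *
        (1 - (Real.log r) ^ 2 / (3 * (p : ℝ) ^ 2 * Real.log p))) := by
  classical
  have hpp : p.Prime := hp ▸ (nextPrime_spec _).1
  have hpN : (p : ℝ) < Real.log (caSeq i) := by
    rw [hp]
    exact h3
  have hp1 : (1 : ℝ) < p := by exact_mod_cast hpp.one_lt
  have hFε : F (p : ℝ) 1 ≤ critEps (i + 1) :=
    F_le_critEps_succ hi hpp (hp ▸ nextPrime_largestPrime_not_dvd (caSeq_pos hi))
  have hFp : Real.log (1 + 1 / (p : ℝ)) / Real.log p ≤ critEps (i + 1) := by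
    simpa [F] using hFε
  obtain ⟨R, hR, hca, hrho⟩ := exists_representing_primes hi
  have hRpos : ∀ r ∈ R, 0 < r ∧ r ≤ p := fun r hr =>
    ⟨((hR r).1 hr).1.pos, ((hR r).1 hr).le_of_F_le hpp hFε⟩
  have hQ0 : 0 < ∏ r ∈ R, r := Finset.prod_pos fun r hr => (hRpos r hr).1
  have hcard := card_le_two_of_represents fun r hr => (hR r).1 hr
  have hlogQ := log_prod_le hpp.pos hRpos hcard
  have hlog_le : ∀ m, 0 < m → m ∣ ∏ r ∈ R, r → Real.log m ≤ Real.log (∏ r ∈ R, r : ℕ) :=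
    fun m hm h => Real.log_le_log (by exact_mod_cast hm)
      (by exact_mod_cast Nat.le_of_dvd hQ0 h)
  have hunique : ∀ q k : ℕ, q.Prime → 1 ≤ k → critEps (i + 1) = F (q : ℝ) k →
      (∀ r j : ℕ, r.Prime → 1 ≤ j → critEps (i + 1) = F (r : ℝ) j → r = q) →
      caSeq (i + 1) = caSeq i * q := fun q k hq hk hqk huniq => by
    have : R = {q} := by
      ext r
      rw [hR, Finset.mem_singleton]
      constructor
      · rintro ⟨hr, j, hj, h⟩
        exact huniq r j hr hj h
      · rintro rfl
        exact ⟨hq, k, hk, hqk⟩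
    rw [hca, this, Finset.prod_singleton]
  have hdvd : ∀ q ∈ R, q ∣ ∏ r ∈ R, r := fun q hq => Finset.dvd_prod_of_mem (fun r => r) hq
  -- The divisor `m` serves only to give `log Q ≥ 3`; the factor obtained involves the whole of `Q`.
  have hsharp : ∀ m, 23 ≤ m → m ∣ ∏ r ∈ R, r → 23 ≤ p → G (caSeq i) < G (caSeq (i + 1)) *
      (1 - (Real.log (∏ r ∈ R, r : ℕ)) ^ 2 / (3 * (p : ℝ) ^ 2 * Real.log p)) :=
    fun m hm hmd hp23 => by
      rw [hca] at hrho ⊢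
      exact G_lt_G_mul_mul (hp1.trans hpN) hQ0 hrho
        (one_add_log_div_log_lt_exp_mul (by exact_mod_cast hp23) hpN
          ((three_le_log hm).trans (hlog_le m (by omega) hmd)) hlogQ hFp)
  have hG : 0 < G (caSeq (i + 1)) := by
    refine div_pos (rho_pos (caSeq_pos (by omega))) (Real.log_pos ((hp1.trans hpN).trans_le ?_))
    refine Real.log_le_log (by exact_mod_cast caSeq_pos hi) ?_
    rw [hca]
    exact_mod_cast Nat.le_mul_of_pos_right _ hQ0
  have hden : 0 < 3 * (p : ℝ) ^ 2 * Real.log p := by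
    have := Real.log_pos hp1
    positivity
  refine ⟨fun q k hq hk hqk hq3 => ⟨hunique q k hq hk hqk, ?_⟩,
    fun q k hq hk hqk hq23 => ⟨hunique q k hq hk hqk, ?_⟩,
    fun q k r j hq hk hr hj hqr hqk hrj hq23 hr23 => ?_⟩
  · have hqR : q ∈ R := (hR q).2 ⟨hq, k, hk, hqk⟩
    rw [hca] at hrho ⊢
    have := G_lt_G_mul_mul (c := 1) (hp1.trans hpN) hQ0 hrho (by
      rw [mul_one]
      exact one_add_log_div_log_lt_exp hp1 hpN
        ((one_le_log hq3).trans (hlog_le q (by omega) (hdvd q hqR))) hFp)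
    rwa [mul_one] at this
  · have hqR : q ∈ R := (hR q).2 ⟨hq, k, hk, hqk⟩
    refine (hsharp q hq23 (hdvd q hqR) (hq23.trans (hRpos q hqR).2)).trans_le ?_
    have := hlog_le q (by omega) (hdvd q hqR)
    have := Real.log_natCast_nonneg q
    gcongr
  · have hqR : q ∈ R := (hR q).2 ⟨hq, k, hk, hqk⟩
    have hrR : r ∈ R := (hR r).2 ⟨hr, j, hj, hrj⟩
    -- Two distinct elements exhaust `R`, since at most two primes represent `ε_{i+1}`.
    have hRqr : R = {q, r} := by
      refine (Finset.eq_of_subset_of_card_le ?_ ?_).symm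
      · intro x hx
        rcases Finset.mem_insert.1 hx with rfl | hx
        · exact hqR
        · rwa [Finset.mem_singleton.1 hx]
      · rwa [Finset.card_pair hqr]
    have hprod : ∏ r ∈ R, r = q * r := by rw [hRqr, Finset.prod_pair hqr]
    refine ⟨by rw [hca, hprod], ?_⟩
    refine (hsharp q hq23 (hdvd q hqR) (hq23.trans (hRpos q hqR).2)).trans_le ?_
    rw [mul_assoc (G _)]
    refine mul_le_mul_of_nonneg_left ?_ hG.le
    rw [hprod, Nat.cast_mul, Real.log_mul (by exact_mod_cast hq.ne_zero)
      (by exact_mod_cast hr.ne_zero)]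
    have h1 := Real.log_natCast_nonneg q
    have h2 := Real.log_natCast_nonneg r
    -- The factor for `Q = q r` is the stronger one: expanding the square adds a nonnegative cross
    -- term to the loss, while the product of the two separate factors gains one.
    have h4 : (Real.log q + Real.log r) ^ 2 / (3 * (p : ℝ) ^ 2 * Real.log p) =
        (Real.log q) ^ 2 / (3 * (p : ℝ) ^ 2 * Real.log p) +
        (Real.log r) ^ 2 / (3 * (p : ℝ) ^ 2 * Real.log p) +
        2 * Real.log q * Real.log r / (3 * (p : ℝ) ^ 2 * Real.log p) := by ring
    have h5 : 0 ≤ 2 * Real.log q * Real.log r / (3 * (p : ℝ) ^ 2 * Real.log p) := by positivity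
    have h6 : 0 ≤ (Real.log q) ^ 2 / (3 * (p : ℝ) ^ 2 * Real.log p) *
        ((Real.log r) ^ 2 / (3 * (p : ℝ) ^ 2 * Real.log p)) := by positivity
    rw [h4]
    linarith
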